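/- Let $D=\left(\frac{-1,-1}{\mathbb Q}\right)$ be the Hamilton quaternion algebra over $\mathbb Q$ with standard basis $1,i,j,k=ij$ and reduced norm $\mathrm{Nrd}$. Put $\rho=\frac12(1+i+j+k)$, let $\mathcal A=\mathbb Z\oplus\mathbb Zi\oplus\mathbb Zj\oplus\mathbb Z\rho$ be the Hurwitz order and $\mathcal A_L=\mathbb Z\oplus\mathbb Zi\oplus\mathbb Zj\oplus\mathbb Zk$ the Lipschitz order. Let $S$ be a finite set of places of $\mathbb Q$ containing $\{2,\infty\}$, put $S_0=S\setminus\{2,\infty\}$, let $\mathbb Z_S\subseteq\mathbb Q$ be the ring of fractions whose denominators are products of primes in $S$, put $\mathcal A(\mathbb Z_S)=\mathcal A\otimes\mathbb Z_S$, and let $\Lambda_S=\mathcal A(\mathbb Z_S)^\times/\mathbb Z_S^\times$. Let $\mathfrak O_2$ be the maximal order of the skew field $D\otimes\mathbb Q_2$, with maximal ideal $\mathfrak m_2$ (generated by $i-j$), and let $U^2=1+\mathfrak m_2^2$. For an odd prime $p$ let $A_p$ be the set of all $x\in\mathcal A$ with $\mathrm{Nrd}(x)=p$ and $x\in\mathbb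 Q_2^\times\cdot U^2$ in $(D\otimes\mathbb Q_2)^\times$. Let $A'_p=A_p$ if $p\equiv1\bmod 4$ and $A'_p=A_p\,i$ if $p\equiv3\bmod4$. For $p\in S_0$ let $PA'_p$ be the image of $A'_p$ in $\Lambda_S$, and define $$\Gamma'_S=\langle PA'_p \mid p\in S_0\rangle\subseteq\Lambda_S .$$ For $p\in S_0$ let $T_{p+1}$ be the Bruhat–Tits tree of $(D\otimes\mathbb Q_p)^\times/\mathbb Q_p^\times\cong\mathrm{PGL}_2(\mathbb Q_p)$, where the isomorphism is induced by an arbitrary isomorphism $D\otimes\mathbb Q_p\cong M_2(\mathbb Q_p)$; the group $\Lambda_S$ acts on the cube complex $\prod_{p\in S_0}T_{p+1}$ through its localisations at the $p\in S_0$. Then: 1. Every element of $\Gamma'_S$ has a representative in $\mathcal A_L\cap\mathcal A(\mathbb Z_S)^\times$ that is congruent to $1$ or to $1+j+k$ modulo $2\mathcal A_L$. 2. The action of $\Gamma'_S$ on $\prod_{p\in S_0}T_{p+1}$ is simply transitive on the vertices, and no non-trivial element of $\Gamma'_S$ maps a cell of $\prod_{p\in S_0}T_{p+1}$ to itself. In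 particular, $\Gamma'_S$ is torsion-free. -/

import Mathlib

open scoped Quaternion Pointwise

noncomputable section

namespace HurwitzLattice

/-! ### Places and `S`-integers -/

/-- The places of `ℚ`. -/
inductive Place : Type
  | finite (p : Nat.Primes) : Place
  | infinite : Place

/-- The place `2`. -/
def Place.two : Place := Place.finite ⟨2, Nat.prime_two⟩

/-- The set of places `B = {2, ∞}`, at which the Hamilton quaternions over `ℚ` ramify. -/
def ramified : Set Place := {Place.two, Place.infinite}

/-- `S₀ = S \ B`, as a set of (necessarily odd) prime numbers. -/
def unramified (S : Set Place) : Set Nat.Primes :=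
  {p | Place.finite p ∈ S \ ramified}

instance (p : Nat.Primes) : Fact p.1.Prime := ⟨p.2⟩

/-- `ℤ_S`: the fractions whose denominator is a product of primes of `S`. -/
def sIntegers (S : Set Place) : Subring ℚ where
  carrier := {q | ∀ p : Nat.Primes, p.1 ∣ q.den → Place.finite p ∈ S}
  mul_mem' {a b} ha hb p hp :=
    (p.2.dvd_mul.1 (hp.trans (Rat.mul_den_dvd a b))).elim (ha p) (hb p)
  one_mem' p hp := absurd (Nat.dvd_one.1 (by simpa using hp)) p.2.ne_one
  add_mem' {a b} ha hb p hp :=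
    (p.2.dvd_mul.1 (hp.trans (Rat.add_den_dvd a b))).elim (ha p) (hb p)
  zero_mem' p hp := absurd (Nat.dvd_one.1 (by simpa using hp)) p.2.ne_one
  neg_mem' {a} ha p hp := ha p (by simpa using hp)

/-! ### The Hurwitz and the Lipschitz order -/

section

variable {R : Type*} [CommRing R] (a b c d : R)

/-- The quaternion `a + b i + c j + d k`. -/
def quat : ℍ[R] := ⟨a, b, c, d⟩

@[simp] theorem quat_re : (quat a b c d).re = a := rfl
@[simp] theorem quat_imI : (quat a b c d).imI = b := rfl
@[simp] theorem quat_imJ : (quat a b c d).imJ = c := rfl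
@[simp] theorem quat_imK : (quat a b c d).imK = d := rfl

end

/-- The unit `i` in the quaternions over a commutative ring. -/
def qi (R : Type*) [CommRing R] : ℍ[R] := quat 0 1 0 0
/-- The unit `j`. -/
def qj (R : Type*) [CommRing R] : ℍ[R] := quat 0 0 1 0
/-- The unit `k`. -/
def qk (R : Type*) [CommRing R] : ℍ[R] := quat 0 0 0 1

/-- `ρ = (1 + i + j + k) / 2`. -/
def rho : ℍ[ℚ] := quat (1 / 2) (1 / 2) (1 / 2) (1 / 2)

/-- The Hurwitz maximal order `𝒜 = ℤ ⊕ ℤ i ⊕ ℤ j ⊕ ℤ ρ`. -/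
def hurwitz : Submodule ℤ ℍ[ℚ] := Submodule.span ℤ {1, qi ℚ, qj ℚ, rho}

/-- The Lipschitz order `𝒜_L = ℤ ⊕ ℤ i ⊕ ℤ j ⊕ ℤ k`. -/
def lipschitz : Submodule ℤ ℍ[ℚ] := Submodule.span ℤ {1, qi ℚ, qj ℚ, qk ℚ}

/-- `𝒜(ℤ_S) = 𝒜 ⊗ ℤ_S`, realised inside `ℍ[ℚ]` as the `ℤ_S`-subalgebra generated by `𝒜`. -/
def hurwitzS (S : Set Place) : Subalgebra (sIntegers S) ℍ[ℚ] :=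
  Algebra.adjoin (sIntegers S) (hurwitz : Set ℍ[ℚ])

/-- `ℤ_Sˣ` as a subgroup of `𝒜(ℤ_S)ˣ`. -/
def scalarUnits (S : Set Place) : Subgroup (hurwitzS S)ˣ :=
  (Units.map (algebraMap (sIntegers S) (hurwitzS S)).toMonoidHom).range

instance (S : Set Place) : (scalarUnits S).Normal where
  conj_mem := by
    rintro _ ⟨c, rfl⟩ g
    refine ⟨c, ?_⟩
    rw [eq_mul_inv_iff_mul_eq]
    ext1
    exact Algebra.commutes (c : sIntegers S) (g : hurwitzS S)

/-- The `S`-arithmetic group `Λ_S = 𝒜(ℤ_S)ˣ / ℤ_Sˣ`. -/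
abbrev Lambda (S : Set Place) : Type := (hurwitzS S)ˣ ⧸ scalarUnits S

/-! ### The generators -/

/-- The base change `ℍ[R] → ℍ[R']` along a ring homomorphism `R → R'`. -/
def baseChange {R R' : Type*} [CommRing R] [CommRing R'] (f : R →+* R') : ℍ[R] →+* ℍ[R'] where
  toFun x := quat (f x.re) (f x.imI) (f x.imJ) (f x.imK)
  map_one' := by ext <;> simp
  map_zero' := by ext <;> simp
  map_add' x y := by ext <;> simp
  map_mul' x y := by ext <;> simp

/-- The completion map `ℍ[ℚ] → ℍ[ℚ_p]`. -/
def toPadic (p : ℕ) [Fact p.Prime] : ℍ[ℚ] →+* ℍ[ℚ_[p]] := baseChange (algebraMap ℚ ℚ_[p])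

/-- The maximal order of the skew field `ℍ[ℚ_2]`: the elements of integral reduced norm. -/
def maxOrderTwo : Set ℍ[ℚ_[2]] := {x | ‖Quaternion.normSq x‖ ≤ 1}

/-- The higher unit group `U^n = 1 + 𝔪^n` of `ℍ[ℚ_2]`, where the maximal ideal `𝔪` of the maximal
order is generated by `π = i - j`. -/
def higherUnits (n : ℕ) : Set ℍ[ℚ_[2]] :=
  {x | ∃ y ∈ maxOrderTwo, x = 1 + (qi ℚ_[2] - qj ℚ_[2]) ^ n * y}

/-- The condition `ψ(x) = 1`: `x` becomes trivial in `ℍ[ℚ_2]ˣ / (ℚ_2ˣ ⬝ U²)`. -/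
def PsiTrivial (x : ℍ[ℚ]) : Prop :=
  ∃ c : ℚ_[2], c ≠ 0 ∧ ∃ u ∈ higherUnits 2, toPadic 2 x = c • u

/-- `A_p`: the Hurwitz quaternions `x` of reduced norm `p` with `ψ(x) = 1`. -/
def genA (p : ℕ) : Set ℍ[ℚ] :=
  {x | x ∈ hurwitz ∧ Quaternion.normSq x = p ∧ PsiTrivial x}

/-- `A'_p`: this is `A_p` if `p ≡ 1 mod 4` and `A_p i` if `p ≡ 3 mod 4` (for odd `p`). -/
def genA' (p : ℕ) : Set ℍ[ℚ] :=
  if p % 4 = 1 then genA p else (fun x => x * qi ℚ) '' genA p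

/-- `PA'_p`: the image of `A'_p` in `Λ_S` (for `p ∈ S₀`, when `A'_p ⊆ 𝒜(ℤ_S)ˣ`). -/
def genPA' (S : Set Place) (p : ℕ) : Set (Lambda S) :=
  {g | ∃ u : (hurwitzS S)ˣ, ((u : hurwitzS S) : ℍ[ℚ]) ∈ genA' p ∧ (u : Lambda S) = g}

/-- `Γ'_S`: the subgroup of `Λ_S` generated by the `PA'_p` with `p ∈ S₀`. -/
def Gamma' (S : Set Place) : Subgroup (Lambda S) :=
  Subgroup.closure (⋃ p ∈ unramified S, genPA' S p.1)

/-! ### The Bruhat-Tits tree of `PGL_2(ℚ_p)` -/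

section Tree

variable (p : ℕ) [Fact p.Prime]

/-- `2 × 2` matrices over `ℚ_p`. -/
abbrev Mat : Type := Matrix (Fin 2) (Fin 2) ℚ_[p]

/-- The `ℤ_p`-lattices in `ℚ_p²`. -/
def PadicLattice : Type :=
  {L : Submodule ℤ_[p] (Fin 2 → ℚ_[p]) // L.IsLattice ℚ_[p]}

variable {p}

/-- The `ℤ_p`-linear endomorphism of `ℚ_p²` given by a matrix. -/
def matAct (g : Mat p) : (Fin 2 → ℚ_[p]) →ₗ[ℤ_[p]] (Fin 2 → ℚ_[p]) :=
  (Matrix.toLin' g).restrictScalars ℤ_[p]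

theorem isLattice_map (g : (Mat p)ˣ) (L : Submodule ℤ_[p] (Fin 2 → ℚ_[p]))
    (hL : L.IsLattice ℚ_[p]) : (L.map (matAct (g : Mat p))).IsLattice ℚ_[p] where
  fg := hL.fg.map _
  span_eq_top := by
    have h : ((L.map (matAct (g : Mat p)) : Submodule ℤ_[p] _) : Set (Fin 2 → ℚ_[p]))
        = Matrix.toLin' (g : Mat p) '' (L : Set (Fin 2 → ℚ_[p])) := rfl
    rw [h, Submodule.span_image, hL.span_eq_top, Submodule.map_top, LinearMap.range_eq_top]
    intro v
    refine ⟨Matrix.toLin' ((g⁻¹ : (Mat p)ˣ) : Mat p) v, ?_⟩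
    rw [← LinearMap.comp_apply, ← Matrix.toLin'_mul, Units.mul_inv]
    simp

/-- `GL_2(ℚ_p)` acts on lattices by `g • L = g(L)`. -/
instance : MulAction (Mat p)ˣ (PadicLattice p) where
  smul g L := ⟨L.1.map (matAct (g : Mat p)), isLattice_map g L.1 L.2⟩
  one_smul L := Subtype.ext <| by
    change L.1.map (matAct ((1 : (Mat p)ˣ) : Mat p)) = L.1
    have : matAct ((1 : (Mat p)ˣ) : Mat p) = LinearMap.id := by ext; simp [matAct]
    rw [this, Submodule.map_id]
  mul_smul g h L := Subtype.ext <| by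
    change L.1.map (matAct ((g * h : (Mat p)ˣ) : Mat p))
      = (L.1.map (matAct (h : Mat p))).map (matAct (g : Mat p))
    rw [← Submodule.map_comp]
    congr 1
    ext1 v
    simp [matAct, Matrix.toLin'_mul]

/-- The scalar matrix `c`, for `c ∈ ℚ_pˣ`. -/
def scalarMat (c : ℚ_[p]ˣ) : (Mat p)ˣ :=
  Units.map (algebraMap ℚ_[p] (Mat p)).toMonoidHom c

theorem scalarMat_comm (c : ℚ_[p]ˣ) (g : (Mat p)ˣ) : g * scalarMat c = scalarMat c * g := by
  ext1
  exact (Algebra.commutes (c : ℚ_[p]) (g : Mat p)).symm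

/-- Homothety of lattices: `L' = c L` for some `c ∈ ℚ_pˣ`. -/
instance homothety : Setoid (PadicLattice p) where
  r L L' := ∃ c : ℚ_[p]ˣ, L' = scalarMat c • L
  iseqv :=
    { refl := fun L => ⟨1, by simp [scalarMat]⟩
      symm := by
        rintro L _ ⟨c, rfl⟩
        exact ⟨c⁻¹, by simp [scalarMat]⟩
      trans := by
        rintro L _ _ ⟨c, rfl⟩ ⟨d, rfl⟩
        exact ⟨d * c, by simp [scalarMat, mul_smul]⟩ }

variable (p) in
/-- The vertices of the Bruhat-Tits tree of `PGL_2(ℚ_p)`: homothety classes of lattices. -/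
def Vertex : Type := Quotient (homothety (p := p))

/-- The Bruhat-Tits tree of `PGL_2(ℚ_p)`: two classes are adjacent if they have representatives
`L`, `L'` with `p L ⊊ L' ⊊ L`. -/
def tree : SimpleGraph (Vertex p) :=
  SimpleGraph.fromRel fun v w => ∃ L L' : PadicLattice p,
    (Quotient.mk _ L : Vertex p) = v ∧ (Quotient.mk _ L' : Vertex p) = w ∧
      L'.1 < L.1 ∧ ((p : ℤ_[p]) • L.1) < L'.1

/-- The action of `GL_2(ℚ_p)` on the vertices of the tree. -/
instance : MulAction (Mat p)ˣ (Vertex p) where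
  smul g := Quotient.map (fun L => g • L) <| by
    rintro L _ ⟨c, rfl⟩
    exact ⟨c, by rw [← mul_smul, ← mul_smul, scalarMat_comm]⟩
  one_smul v := Quotient.inductionOn v fun L =>
    congrArg (Quotient.mk homothety) (one_smul (Mat p)ˣ L)
  mul_smul g h v := Quotient.inductionOn v fun L =>
    congrArg (Quotient.mk homothety) (mul_smul g h L)

theorem scalarMat_smul (c : ℚ_[p]ˣ) (v : Vertex p) : scalarMat c • v = v :=
  Quotient.inductionOn v fun _ =>
    (Quotient.sound (s := homothety) (show ∃ _ : ℚ_[p]ˣ, _ from ⟨c, rfl⟩)).symm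

/-- The cells of the tree, given by their vertex sets: vertices and edges. -/
def IsTreeCell (s : Set (Vertex p)) : Prop :=
  (∃ v, s = {v}) ∨ ∃ v w, (tree (p := p)).Adj v w ∧ s = {v, w}

end Tree

/-! ### The action on the product of trees -/

/-- A splitting of the quaternions at `p`, that is, an isomorphism `ℍ[ℚ_p] ≃ M_2(ℚ_p)`. -/
abbrev Splitting (p : ℕ) [Fact p.Prime] : Type := ℍ[ℚ_[p]] ≃ₐ[ℚ_[p]] Mat p

/-- `-1` is a sum of two squares in `ℚ_p`, for odd `p`. -/
theorem exists_sq_add_sq (p : ℕ) [Fact p.Prime] (hp : p ≠ 2) :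
    ∃ a b : ℚ_[p], a ^ 2 + b ^ 2 = -1 := by
  have key : ∀ x y : ZMod p, x ^ 2 + y ^ 2 = -1 → x ≠ 0 →
      ∃ a b : ℚ_[p], a ^ 2 + b ^ 2 = -1 := by
    intro x y h hx
    obtain ⟨x', rfl⟩ := ZMod.intCast_surjective x
    obtain ⟨y', rfl⟩ := ZMod.intCast_surjective y
    have h2 : ‖(2 : ℤ_[p]) * (x' : ℤ_[p])‖ = 1 := by
      refine le_antisymm (PadicInt.norm_le_one _) (not_lt.1 fun hlt => hx ?_)
      have h3 : (p : ℤ) ∣ 2 * x' := (PadicInt.norm_int_lt_one_iff_dvd _).1 (by push_cast; exact hlt)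
      rw [ZMod.intCast_zmod_eq_zero_iff_dvd]
      rcases (Nat.prime_iff_prime_int.1 Fact.out).dvd_or_dvd h3 with h4 | h4
      · exact absurd ((Nat.prime_dvd_prime_iff_eq Fact.out Nat.prime_two).1
          (by exact_mod_cast h4)) hp
      · exact h4
    have h1 : ‖(x' : ℤ_[p]) ^ 2 + ((y' : ℤ_[p]) ^ 2 + 1)‖ < 1 := by
      have h3 : ‖((x' ^ 2 + (y' ^ 2 + 1) : ℤ) : ℤ_[p])‖ < 1 := by
        rw [PadicInt.norm_int_lt_one_iff_dvd, ← ZMod.intCast_zmod_eq_zero_iff_dvd]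
        push_cast
        linear_combination h
      push_cast at h3
      exact h3
    obtain ⟨z, hz, -⟩ := hensels_lemma (p := p) (R := ℤ_[p])
      (F := Polynomial.X ^ 2 + Polynomial.C ((y' : ℤ_[p]) ^ 2 + 1)) (a := (x' : ℤ_[p])) (by
        simp only [Polynomial.coe_aeval_eq_eval, Polynomial.eval_add, Polynomial.eval_pow,
          Polynomial.eval_X, Polynomial.eval_C, Polynomial.derivative_add,
          Polynomial.derivative_X_pow, Polynomial.derivative_C, Polynomial.eval_mul, add_zero]
        norm_num [h2]
        simpa [h2] using h1)
    refine ⟨z, (y' : ℤ_[p]), ?_⟩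
    have h3 : z ^ 2 + ((y' : ℤ_[p]) ^ 2 + 1) = 0 := by simpa using hz
    have h4 := congrArg (fun t : ℤ_[p] => (t : ℚ_[p])) h3
    push_cast at h4
    push_cast
    linear_combination h4
  obtain ⟨x, y, h⟩ := ZMod.sq_add_sq p (-1)
  by_cases hx : x = 0
  · refine key y x (by rw [add_comm, h]) fun hy => ?_
    subst hx hy
    simp at h
  · exact key x y h hx

/-- The quaternions split at every odd prime. -/
theorem nonempty_splitting (p : ℕ) [Fact p.Prime] (hp : p ≠ 2) : Nonempty (Splitting p) := by
  obtain ⟨a, b, h⟩ := exists_sq_add_sq p hp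
  let B : QuaternionAlgebra.Basis (Mat p) (-1 : ℚ_[p]) 0 (-1) :=
    { i := !![0, -1; 1, 0]
      j := !![a, b; b, -a]
      k := !![-b, a; a, b]
      i_mul_i := by ext i j; fin_cases i <;> fin_cases j <;> simp
      j_mul_j := by
        ext i j
        fin_cases i <;> fin_cases j <;> simp <;> first | linear_combination h | ring
      i_mul_j := by ext i j; fin_cases i <;> fin_cases j <;> simp
      j_mul_i := by ext i j; fin_cases i <;> fin_cases j <;> simp }
  let f : ℍ[ℚ_[p]] →ₐ[ℚ_[p]] Mat p := B.liftHom
  have hinj : Function.Injective f := by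
    rw [injective_iff_map_eq_zero]
    intro q hq
    have hq' : B.lift q = 0 := hq
    have e : ∀ i j, B.lift q i j = 0 := fun i j => by rw [hq']; rfl
    have e00 := e 0 0
    have e01 := e 0 1
    have e10 := e 1 0
    have e11 := e 1 1
    simp [QuaternionAlgebra.Basis.lift, B, Algebra.algebraMap_eq_smul_one] at e00 e01 e10 e11
    refine Quaternion.ext _ _ ?_ ?_ ?_ ?_
    · change q.re = 0
      linear_combination (e00 + e11) / 2
    · change q.imI = 0
      linear_combination (e10 - e01) / 2
    · change q.imJ = 0
      linear_combination q.imJ * h - a * (e00 - e11) / 2 - b * (e01 + e10) / 2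
    · change q.imK = 0
      linear_combination q.imK * h + b * (e00 - e11) / 2 - a * (e01 + e10) / 2
  exact ⟨AlgEquiv.ofBijective f ⟨hinj, (LinearMap.injective_iff_surjective_of_finrank_eq_finrank
    (f := f.toLinearMap) (by simp [Quaternion.finrank_eq_four, Module.finrank_matrix])).1 hinj⟩⟩

/-- The vertices of the product of trees `∏_{p ∈ S₀} T_{p+1}`. -/
abbrev ProductVertex (S : Set Place) : Type := ∀ p : unramified S, Vertex p.1.1

/-- The cells of the product of trees, given by their vertex sets: products of cells of the
factors. -/
def IsCell {S : Set Place} (C : Set (ProductVertex S)) : Prop :=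
  ∃ c : ∀ p : unramified S, Set (Vertex p.1.1), (∀ p, IsTreeCell (c p)) ∧ C = Set.univ.pi c

section Action

variable {S : Set Place} (φ : ∀ p : unramified S, Splitting p.1.1)

/-- The localisation `𝒜(ℤ_S)ˣ → ℍ[ℚ_p]ˣ ≃ GL_2(ℚ_p)` at `p ∈ S₀`. -/
def localise (p : unramified S) : (hurwitzS S)ˣ →* (Mat p.1.1)ˣ :=
  Units.map ((φ p : ℍ[ℚ_[p.1.1]] →* Mat p.1.1).comp
    (((toPadic p.1.1).comp (hurwitzS S).val.toRingHom) : hurwitzS S →* ℍ[ℚ_[p.1.1]]))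

/-- `𝒜(ℤ_S)ˣ` acts on the vertices of the product of trees, factor by factor. -/
def unitsAction : (hurwitzS S)ˣ →* Equiv.Perm (ProductVertex S) where
  toFun u := Equiv.piCongrRight fun p => MulAction.toPerm (localise φ p u)
  map_one' := by ext v p; simp
  map_mul' u w := by ext v p; simp [mul_smul]

theorem unitsAction_scalar (u : (hurwitzS S)ˣ) (hu : u ∈ scalarUnits S) :
    unitsAction φ u = 1 := by
  obtain ⟨c, rfl⟩ := hu
  ext1 v
  funext p
  have hc : IsUnit ((c : sIntegers S) : ℚ) := c.isUnit.map (sIntegers S).subtype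
  obtain ⟨d, hd⟩ := hc.map (algebraMap ℚ ℚ_[p.1.1])
  have h : localise φ p (Units.map (algebraMap (sIntegers S) (hurwitzS S)).toMonoidHom c)
      = scalarMat d := by
    ext1
    have h1 : toPadic p.1.1 (((c : sIntegers S) : ℚ) : ℍ[ℚ]) = algebraMap ℚ_[p.1.1] _ d := by
      rw [hd]
      refine Quaternion.ext _ _ ?_ ?_ ?_ ?_ 
      · exact rfl
      all_goals exact map_zero (algebraMap ℚ ℚ_[p.1.1])
    change φ p (toPadic p.1.1 (((c : sIntegers S) : ℚ) : ℍ[ℚ])) = algebraMap ℚ_[p.1.1] _ d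
    rw [h1, AlgEquiv.commutes]
  change localise φ p _ • v p = v p
  rw [h, scalarMat_smul]

/-- The action of `Λ_S` on the vertices of the product of trees. -/
def lambdaAction : Lambda S →* Equiv.Perm (ProductVertex S) :=
  QuotientGroup.lift (scalarUnits S) (unitsAction φ) (unitsAction_scalar φ)

end Action

end HurwitzLattice

end

open HurwitzLattice

namespace HurwitzLattice

/-! Transitivity comes from unique-factorisation arguments in the norm-Euclidean Hurwitz order,
freeness from a congruence modulo 2.

A Hurwitz quaternion of norm divisible by an odd prime `p` has a left divisor of norm `p`, which a
unit on the right moves into `A'_p` (`exists_factor_genA'`). Conversely, the norm and trace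
conditions modulo 4 hidden in `PsiTrivial` force every element of `A'_p` to be integral and
congruent to 1 or `1 + j + k` modulo 2 (`isPrincipalLipschitz_of_mem_genA'`). These classes are
closed under multiplication and conjugation, so each element of `Γ'_S` has such a representative,
with norm a product of primes of `S` (`exists_isGoodUnit`).

At odd `p` the order `ℤ_p⟨1, i, j, k⟩` is the full stabiliser ring of a lattice. This gives a base
vertex whose stabiliser consists of the scalar multiples of the units of the order. A vertex of the
product is the translate of the origin by a family of integral local quaternions; splitting off
elements of `A'_q` on the left lowers the valuations of their norms to zero, which proves
transitivity (`exists_smul_origin`). If `γ` fixes the origin, its representative is a scalar times a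
local unit at each prime dividing its norm. Cancelling those primes leaves an integral quaternion of
norm 1 with odd real part, namely `±1`, so `γ = 1` (`eq_one_of_fix_origin`).

If `γ` preserves a cell, then `γ²` fixes a vertex, so `γ² = 1`. The imaginary part of the square of
a representative is twice its odd real part times its imaginary part, so `γ = 1`. Torsion of odd
order is excluded by a parity argument on powers. -/

/-! ### Arithmetic of the Hurwitz order -/

theorem mem_hurwitz {x : ℍ[ℚ]} : x ∈ hurwitz ↔ ∃ a b c d : ℤ,
    x = quat (a + d / 2 : ℚ) (b + d / 2) (c + d / 2) (d / 2) := by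
  simp only [hurwitz, Submodule.mem_span_insert, Submodule.mem_span_singleton]
  constructor
  · rintro ⟨a, _, ⟨b, _, ⟨c, _, ⟨d, rfl⟩, rfl⟩, rfl⟩, rfl⟩
    refine ⟨a, b, c, d, ?_⟩
    ext <;> simp [qi, qj, rho] <;> ring
  · rintro ⟨a, b, c, d, rfl⟩
    refine ⟨a, _, ⟨b, _, ⟨c, _, ⟨d, rfl⟩, rfl⟩, rfl⟩, ?_⟩
    ext <;> simp [qi, qj, rho] <;> ring

theorem mem_lipschitz {x : ℍ[ℚ]} : x ∈ lipschitz ↔ ∃ a b c d : ℤ, x = quat (a : ℚ) b c d := by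
  simp only [lipschitz, Submodule.mem_span_insert, Submodule.mem_span_singleton]
  constructor
  · rintro ⟨a, _, ⟨b, _, ⟨c, _, ⟨d, rfl⟩, rfl⟩, rfl⟩, rfl⟩
    refine ⟨a, b, c, d, ?_⟩
    ext <;> simp [qi, qj, qk]
  · rintro ⟨a, b, c, d, rfl⟩
    refine ⟨a, _, ⟨b, _, ⟨c, _, ⟨d, rfl⟩, rfl⟩, rfl⟩, ?_⟩
    ext <;> simp [qi, qj, qk]

theorem quat_int_mem_hurwitz (a b c d : ℤ) : quat (a : ℚ) b c d ∈ hurwitz :=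
  mem_hurwitz.2 ⟨a - d, b - d, c - d, 2 * d, by ext <;> simp⟩

theorem intCast_mem_hurwitz (n : ℤ) : (n : ℍ[ℚ]) ∈ hurwitz := by
  simpa [quat] using! quat_int_mem_hurwitz n 0 0 0

theorem one_mem_hurwitz : (1 : ℍ[ℚ]) ∈ hurwitz := by
  simpa using intCast_mem_hurwitz 1

theorem qi_mem_hurwitz : qi ℚ ∈ hurwitz := by
  simpa [qi] using quat_int_mem_hurwitz 0 1 0 0

theorem mul_mem_hurwitz {x y : ℍ[ℚ]} (hx : x ∈ hurwitz) (hy : y ∈ hurwitz) :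
    x * y ∈ hurwitz := by
  obtain ⟨a, b, c, d, rfl⟩ := mem_hurwitz.1 hx
  obtain ⟨A, B, C, D, rfl⟩ := mem_hurwitz.1 hy
  refine mem_hurwitz.2 ⟨a * A - b * B - c * C - d * D - b * D - b * C + c * B - d * C,
    a * B + b * A + d * B - b * C + c * B + c * D - d * C,
    a * C + c * A + c * B - b * C + c * D + d * B - b * D,
    a * D + d * D + 2 * b * C + b * D + d * C - 2 * c * B - c * D - d * B + d * A, ?_⟩
  ext <;> simp <;> ring

theorem star_mem_hurwitz {x : ℍ[ℚ]} (hx : x ∈ hurwitz) : star x ∈ hurwitz := by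
  obtain ⟨a, b, c, d, rfl⟩ := mem_hurwitz.1 hx
  refine mem_hurwitz.2 ⟨a + d, -b, -c, -d, ?_⟩
  ext <;> simp <;> ring

theorem exists_normSq_eq {x : ℍ[ℚ]} (hx : x ∈ hurwitz) :
    ∃ n : ℤ, Quaternion.normSq x = n := by
  obtain ⟨a, b, c, d, rfl⟩ := mem_hurwitz.1 hx
  refine ⟨a ^ 2 + b ^ 2 + c ^ 2 + d ^ 2 + a * d + b * d + c * d, ?_⟩
  simp [Quaternion.normSq_def']
  ring

theorem exists_two_mul_re_eq {x : ℍ[ℚ]} (hx : x ∈ hurwitz) : ∃ n : ℤ, 2 * x.re = n := by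
  obtain ⟨a, b, c, d, rfl⟩ := mem_hurwitz.1 hx
  refine ⟨2 * a + d, ?_⟩
  simp
  ring

/-- The Hurwitz order is norm-Euclidean. -/
theorem exists_hurwitz_near (x : ℍ[ℚ]) : ∃ q ∈ hurwitz, Quaternion.normSq (x - q) < 1 := by
  -- Rounding twice the `k`-coordinate leaves an error of at most 1/4 there; the other errors are at
  -- most 1/2, so the norm is at most 1/16 + 3/4.
  set d := round (2 * x.imK) with hd
  have h0 := abs_sub_round (2 * x.imK)
  have h1 := abs_sub_round (x.re - d / 2)
  have h2 := abs_sub_round (x.imI - d / 2)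
  have h3 := abs_sub_round (x.imJ - d / 2)
  refine ⟨_, mem_hurwitz.2 ⟨round (x.re - d / 2), round (x.imI - d / 2),
    round (x.imJ - d / 2), d, rfl⟩, ?_⟩
  rw [← hd] at h0
  simp only [Quaternion.normSq_def', Quaternion.re_sub, Quaternion.imI_sub, Quaternion.imJ_sub,
    Quaternion.imK_sub, quat_re, quat_imI, quat_imJ, quat_imK]
  rw [← sq_le_sq₀ (abs_nonneg _) (by norm_num), sq_abs] at h0 h1 h2 h3
  nlinarith

/-- A right ideal of the Hurwitz order that is not zero is principal. -/
theorem exists_generator (I : AddSubgroup ℍ[ℚ]) (hI : ∀ x ∈ I, x ∈ hurwitz)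
    (hmul : ∀ x ∈ I, ∀ y ∈ hurwitz, x * y ∈ I) (hne : ∃ x ∈ I, x ≠ 0) :
    ∃ x ∈ I, x ≠ 0 ∧ ∀ y ∈ I, ∃ z ∈ hurwitz, y = x * z := by
  have hex : ∃ n : ℕ, ∃ x ∈ I, x ≠ 0 ∧ Quaternion.normSq x = n := by
    obtain ⟨x, hx, h0⟩ := hne
    obtain ⟨n, hn⟩ := exists_normSq_eq (hI x hx)
    have : 0 ≤ n := by
      have := Quaternion.normSq_nonneg (a := x)
      rw [hn] at this
      exact_mod_cast this
    lift n to ℕ using this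
    exact ⟨n, x, hx, h0, by simpa using hn⟩
  classical
  obtain ⟨x, hx, h0, hn⟩ := Nat.find_spec hex
  refine ⟨x, hx, h0, fun y hy => ?_⟩
  obtain ⟨q, hq, hlt⟩ := exists_hurwitz_near (x⁻¹ * y)
  refine ⟨q, hq, ?_⟩
  by_contra hne
  have hw : y - x * q ∈ I := I.sub_mem hy (hmul x hx q hq)
  have hw0 : y - x * q ≠ 0 := sub_ne_zero.2 hne
  obtain ⟨m, hm⟩ := exists_normSq_eq (hI _ hw)
  have hm0 : 0 ≤ m := by
    have := Quaternion.normSq_nonneg (a := y - x * q)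
    rw [hm] at this
    exact_mod_cast this
  lift m to ℕ using hm0
  refine Nat.find_min hex (m := m) ?_ ⟨_, hw, hw0, by simpa using hm⟩
  have h1 : y - x * q = x * (x⁻¹ * y - q) := by
    rw [mul_sub, ← mul_assoc, mul_inv_cancel₀ h0, one_mul]
  rw [h1, map_mul, hn] at hm
  have hpos : (0 : ℚ) < (Nat.find hex : ℚ) := by
    rw [← hn]
    exact lt_of_le_of_ne Quaternion.normSq_nonneg (Quaternion.normSq_ne_zero.2 h0).symm
  have : (m : ℚ) < Nat.find hex := by
    rw [show (m : ℚ) = ((m : ℤ) : ℚ) by simp, ← hm]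
    nlinarith
  exact_mod_cast this

theorem natCast_mul_eq_smul (n : ℕ) (x : ℍ[ℚ]) : (n : ℍ[ℚ]) * x = (n : ℚ) • x := by
  rw [← Quaternion.coe_mul_eq_smul, Quaternion.coe_natCast]

/-- The right ideal `y𝒜 + p𝒜` is principal; let `x` generate it and write `p = x * w`. The norm of
`x` divides `p²` and is divisible by `p`. If it were `p²`, then `w` would be a unit and `p` would
divide `y`. -/
theorem exists_factor_of_not_dvd {p : ℕ} (hp : p.Prime) {y : ℍ[ℚ]} (hy : y ∈ hurwitz) {n : ℤ}
    (hn : Quaternion.normSq y = p * n) (hpy : ∀ z ∈ hurwitz, y ≠ p * z) :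
    ∃ x ∈ hurwitz, Quaternion.normSq x = p ∧ ∃ z ∈ hurwitz, y = x * z := by
  have hp0 : (p : ℚ) ≠ 0 := by exact_mod_cast hp.ne_zero
  let I : AddSubgroup ℍ[ℚ] :=
    { carrier := {w | ∃ s ∈ hurwitz, ∃ t ∈ hurwitz, w = y * s + p * t}
      add_mem' := by
        rintro _ _ ⟨s, hs, t, ht, rfl⟩ ⟨s', hs', t', ht', rfl⟩
        exact ⟨_, add_mem hs hs', _, add_mem ht ht', by noncomm_ring⟩
      zero_mem' := ⟨0, zero_mem _, 0, zero_mem _, by simp⟩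
      neg_mem' := by
        rintro _ ⟨s, hs, t, ht, rfl⟩
        exact ⟨_, neg_mem hs, _, neg_mem ht, by noncomm_ring⟩ }
  have hpmem : (p : ℍ[ℚ]) ∈ hurwitz := by simpa using intCast_mem_hurwitz p
  obtain ⟨x, ⟨s, hs, t, ht, hx⟩, hx0, hgen⟩ := exists_generator I
    (by
      rintro _ ⟨s, hs, t, ht, rfl⟩
      exact add_mem (mul_mem_hurwitz hy hs) (mul_mem_hurwitz hpmem ht))
    (by
      rintro _ ⟨s, hs, t, ht, rfl⟩ z hz
      exact ⟨_, mul_mem_hurwitz hs hz, _, mul_mem_hurwitz ht hz, by noncomm_ring⟩)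
    ⟨p, ⟨0, zero_mem _, 1, one_mem_hurwitz, by simp⟩,
      fun h => hp0 (by simpa using congrArg (fun q : ℍ[ℚ] => q.re) h)⟩
  obtain ⟨z, hz, hyz⟩ := hgen y ⟨1, one_mem_hurwitz, 0, zero_mem _, by simp⟩
  obtain ⟨w, hw, hpw⟩ := hgen p ⟨0, zero_mem _, 1, one_mem_hurwitz, by simp⟩
  have hxA : x ∈ hurwitz := by
    rw [hx]
    exact add_mem (mul_mem_hurwitz hy hs) (mul_mem_hurwitz hpmem ht)
  refine ⟨x, hxA, ?_, z, hz, hyz⟩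
  obtain ⟨N, hN⟩ := exists_normSq_eq hxA
  obtain ⟨M, hM⟩ := exists_normSq_eq hw
  obtain ⟨ns, hns⟩ := exists_normSq_eq hs
  obtain ⟨nt, hnt⟩ := exists_normSq_eq ht
  obtain ⟨T, hT⟩ := exists_two_mul_re_eq
    (mul_mem_hurwitz (mul_mem_hurwitz hy hs) (star_mem_hurwitz ht))
  have hNM : N * M = (p : ℤ) ^ 2 := by
    have := congrArg Quaternion.normSq hpw
    rw [map_mul, hN, hM, Quaternion.normSq_natCast] at this
    exact_mod_cast this.symm
  have hdvd : (p : ℤ) ∣ N := by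
    -- The norm of `y s + p t` is `Nrd(y) Nrd(s) + p T + p² Nrd(t)`, with `T` the trace of `y s t̄`.
    refine ⟨n * ns + T + p * nt, ?_⟩
    have : Quaternion.normSq x = p * (n * ns + T + p * nt) := by
      rw [hx, Quaternion.normSq_add, natCast_mul_eq_smul, Quaternion.normSq_smul, map_mul, hn,
        hns, hnt, star_smul, mul_smul_comm, Quaternion.re_smul, ← hT]
      simp only [star_trivial, smul_eq_mul]
      ring
    rw [hN] at this
    exact_mod_cast this
  obtain ⟨N', rfl⟩ := hdvd
  have hpz : (p : ℤ) ≠ 0 := by exact_mod_cast hp.ne_zero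
  have h1 : N' * M = p := mul_left_cancel₀ hpz (by linear_combination hNM)
  have hNpos : 0 ≤ N' := by
    have := Quaternion.normSq_nonneg (a := x)
    rw [hN] at this
    have h2 : (0 : ℤ) ≤ p * N' := by exact_mod_cast this
    have h3 : (0 : ℤ) < p := by exact_mod_cast hp.pos
    exact nonneg_of_mul_nonneg_right h2 h3
  have hMpos : 0 ≤ M := by
    have := Quaternion.normSq_nonneg (a := w)
    rw [hM] at this
    exact_mod_cast this
  lift N' to ℕ using hNpos
  lift M to ℕ using hMpos
  have h1' : N' * M = p := by exact_mod_cast h1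
  rcases (Nat.dvd_prime hp).1 (Dvd.intro _ h1') with h | h
  · rw [hN, h]
    simp
  · have hM1 : M = 1 := by
      rw [h] at h1'
      exact Nat.eq_of_mul_eq_mul_left hp.pos (by omega)
    exfalso
    have hww : w * star w = 1 := by
      rw [Quaternion.self_mul_star, hM, hM1]
      simp
    refine hpy (star w * z) (mul_mem_hurwitz (star_mem_hurwitz hw) hz) ?_
    rw [hpw, mul_assoc, ← mul_assoc w, hww, one_mul, hyz]

/-- If `p` divides `y`, any `x` of norm `p` is a left divisor, because `p = x x̄`. Such an `x` comes
from the previous case applied to `1 + a i + b j` with `a² + b² ≡ -1` modulo `p`. -/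
theorem exists_factor {p : ℕ} (hp : p.Prime) {y : ℍ[ℚ]} (hy : y ∈ hurwitz) {n : ℤ}
    (hn : Quaternion.normSq y = p * n) :
    ∃ x ∈ hurwitz, Quaternion.normSq x = p ∧ ∃ z ∈ hurwitz, y = x * z := by
  by_cases hpy : ∀ z ∈ hurwitz, y ≠ p * z
  · exact exists_factor_of_not_dvd hp hy hn hpy
  push Not at hpy
  obtain ⟨z, hz, rfl⟩ := hpy
  have : Fact p.Prime := ⟨hp⟩
  obtain ⟨a, b, hab⟩ := ZMod.sq_add_sq p (-1)
  obtain ⟨a, rfl⟩ := ZMod.intCast_surjective a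
  obtain ⟨b, rfl⟩ := ZMod.intCast_surjective b
  have hdvd : (p : ℤ) ∣ 1 + a ^ 2 + b ^ 2 := by
    rw [← ZMod.intCast_zmod_eq_zero_iff_dvd]
    push_cast
    linear_combination hab
  obtain ⟨m, hm⟩ := hdvd
  have hm' : (1 + a ^ 2 + b ^ 2 : ℚ) = p * m := by exact_mod_cast hm
  obtain ⟨x, hx, hxp, -⟩ := exists_factor_of_not_dvd hp (quat_int_mem_hurwitz 1 a b 0) (n := m)
    (by simp [Quaternion.normSq_def', hm']) (by
      rintro w hw h
      obtain ⟨e, f, g, k, rfl⟩ := mem_hurwitz.1 hw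
      have h1 := congrArg (fun q : ℍ[ℚ] => q.re) h
      have h2 := congrArg (fun q : ℍ[ℚ] => q.imK) h
      rw [natCast_mul_eq_smul] at h1 h2
      simp only [quat_re, quat_imK, Quaternion.re_smul, Quaternion.imK_smul, smul_eq_mul] at h1 h2
      have h3 : (p : ℚ) * e = 1 := by push_cast at h1 h2; linear_combination h2 - h1
      have h4 : (p : ℤ) * e = 1 := by exact_mod_cast h3
      exact hp.one_lt.ne' (by exact_mod_cast Int.eq_one_of_mul_eq_one_right (by positivity) h4))
  refine ⟨x, hx, hxp, star x * z, mul_mem_hurwitz (star_mem_hurwitz hx) hz, ?_⟩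
  rw [← mul_assoc, Quaternion.self_mul_star, hxp, Quaternion.coe_natCast]

/-! ### Reduction modulo 2 and the sets `A'_p` -/

/-- Every odd Hurwitz quaternion is congruent to a unit modulo `2`. -/
theorem exists_unit_congr {x : ℍ[ℚ]} (hx : x ∈ hurwitz) {n : ℤ}
    (hn : Quaternion.normSq x = n) (hodd : Odd n) :
    ∃ e ∈ hurwitz, Quaternion.normSq e = 1 ∧ ∃ z ∈ hurwitz, x - e = 2 * z := by
  have h2 : ∀ z : ℍ[ℚ], 2 * z = (2 : ℚ) • z := fun z => by
    simpa using natCast_mul_eq_smul 2 z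
  simp only [h2]
  obtain ⟨a, b, c, d, rfl⟩ := mem_hurwitz.1 hx
  obtain ⟨k, rfl | rfl⟩ := d.even_or_odd'
  · have hsum : Odd ((a + k) + (b + k) + (c + k) + k) := by
      have : ((a + k) ^ 2 + (b + k) ^ 2 + (c + k) ^ 2 + k ^ 2 : ℤ) = n := by
        simp only [Quaternion.normSq_def', quat_re, quat_imI, quat_imJ, quat_imK] at hn
        push_cast at hn
        have : ((a + k) ^ 2 + (b + k) ^ 2 + (c + k) ^ 2 + k ^ 2 : ℚ) = n := by
          linear_combination hn
        exact_mod_cast this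
      rw [← this] at hodd
      simpa [parity_simps] using hodd
    -- The vector `s (1, 1, 1, 1)` is `2 s ρ`, which vanishes modulo `2𝒜`. One or three coordinates
    -- are odd; with `s = 0` or `s = 1` respectively, a single `±1` remains.
    obtain ⟨s, α, β, γ, δ, e, f, g, h, he, h0, h1, h2, h3⟩ : ∃ s α β γ δ e f g h : ℤ,
        e ^ 2 + f ^ 2 + g ^ 2 + h ^ 2 = 1 ∧ a + k = 2 * α + s + e ∧ b + k = 2 * β + s + f ∧
          c + k = 2 * γ + s + g ∧ k = 2 * δ + s + h := by
      generalize a + k = A at *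
      generalize b + k = B at *
      generalize c + k = C at *
      refine ⟨(A % 2 + B % 2 + C % 2 + k % 2) / 2, A / 2, B / 2, C / 2, k / 2,
        A % 2 - (A % 2 + B % 2 + C % 2 + k % 2) / 2, B % 2 - (A % 2 + B % 2 + C % 2 + k % 2) / 2,
        C % 2 - (A % 2 + B % 2 + C % 2 + k % 2) / 2, k % 2 - (A % 2 + B % 2 + C % 2 + k % 2) / 2,
        ?_, by omega, by omega, by omega, by omega⟩
      rw [Int.odd_iff] at hsum
      rcases Int.emod_two_eq_zero_or_one A with hA | hA <;>
      rcases Int.emod_two_eq_zero_or_one B with hB | hB <;>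
      rcases Int.emod_two_eq_zero_or_one C with hC | hC <;>
      rcases Int.emod_two_eq_zero_or_one k with hk | hk <;>
      first | (exfalso; omega) | norm_num [hA, hB, hC, hk]
    have e0 : (a + k : ℚ) = 2 * α + s + e := by exact_mod_cast h0
    have e1 : (b + k : ℚ) = 2 * β + s + f := by exact_mod_cast h1
    have e2 : (c + k : ℚ) = 2 * γ + s + g := by exact_mod_cast h2
    have e3 : (k : ℚ) = 2 * δ + s + h := by exact_mod_cast h3
    refine ⟨_, quat_int_mem_hurwitz e f g h, ?_, _,
      mem_hurwitz.2 ⟨α - δ, β - δ, γ - δ, 2 * δ + s, rfl⟩, ?_⟩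
    · simp only [Quaternion.normSq_def', quat_re, quat_imI, quat_imJ, quat_imK]
      exact_mod_cast he
    · ext <;> simp <;> linarith
  -- Here all coordinates lie in `ℤ + 1/2`, so each is congruent modulo 2 to `1/2` or `-1/2`, and
  -- `(±1 ± i ± j ± k) / 2` is a unit.
  · have key : ∀ m : ℤ, ∃ s t : ℤ, (s = 0 ∨ s = -1) ∧ m = s + 2 * t := fun m => by
      obtain ⟨t, rfl | rfl⟩ := m.even_or_odd'
      · exact ⟨0, t, by simp, by ring⟩
      · exact ⟨-1, t + 1, by simp, by ring⟩
    have hsq : ∀ s : ℤ, s = 0 ∨ s = -1 → (s + 1 / 2 : ℚ) ^ 2 = 1 / 4 := by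
      rintro s (rfl | rfl) <;> norm_num
    obtain ⟨s0, t0, hs0, h0⟩ := key (a + k)
    obtain ⟨s1, t1, hs1, h1⟩ := key (b + k)
    obtain ⟨s2, t2, hs2, h2⟩ := key (c + k)
    obtain ⟨s3, t3, hs3, h3⟩ := key k
    have e0 : (a + k : ℚ) = s0 + 2 * t0 := by exact_mod_cast h0
    have e1 : (b + k : ℚ) = s1 + 2 * t1 := by exact_mod_cast h1
    have e2 : (c + k : ℚ) = s2 + 2 * t2 := by exact_mod_cast h2
    have e3 : (k : ℚ) = s3 + 2 * t3 := by exact_mod_cast h3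
    refine ⟨quat (s0 + 1 / 2) (s1 + 1 / 2) (s2 + 1 / 2) (s3 + 1 / 2),
      mem_hurwitz.2 ⟨s0 - s3, s1 - s3, s2 - s3, 2 * s3 + 1, ?_⟩, ?_, _,
      quat_int_mem_hurwitz t0 t1 t2 t3, ?_⟩
    · ext <;> simp <;> ring
    · simp only [Quaternion.normSq_def', quat_re, quat_imI, quat_imJ, quat_imK]
      rw [hsq s0 hs0, hsq s1 hs1, hsq s2 hs2, hsq s3 hs3]
      norm_num
    · ext <;> simp <;> linarith

theorem norm_ratInt_le_one {p : ℕ} [Fact p.Prime] {q : ℚ} {n : ℤ} (h : q = n) :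
    ‖(algebraMap ℚ ℚ_[p]) q‖ ≤ 1 := by
  rw [h, map_intCast]
  exact Padic.norm_int_le_one n

theorem normSq_toPadic (p : ℕ) [Fact p.Prime] (x : ℍ[ℚ]) :
    Quaternion.normSq (toPadic p x) = algebraMap ℚ ℚ_[p] (Quaternion.normSq x) := by
  simp only [Quaternion.normSq_def', map_add, map_pow]
  rfl

/-- Since `(i - j)² = -2`, the group `U²` is `1 + 2𝔒₂`, so the scalar 1 suffices. -/
theorem psiTrivial_of_congr {x z : ℍ[ℚ]} (hz : z ∈ hurwitz) (h : x = 1 + 2 * z) :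
    PsiTrivial x := by
  refine ⟨1, one_ne_zero, _, ⟨-toPadic 2 z, ?_, rfl⟩, ?_⟩
  · obtain ⟨n, hn⟩ := exists_normSq_eq hz
    change ‖_‖ ≤ 1
    rw [Quaternion.normSq_neg, normSq_toPadic]
    exact norm_ratInt_le_one hn
  · have : (qi ℚ_[2] - qj ℚ_[2]) ^ 2 = -2 := by
      have : (-2 : ℍ[ℚ_[2]]) = ((-2 : ℚ_[2]) : ℍ[ℚ_[2]]) := by push_cast; rfl
      rw [pow_two, this]
      ext <;> simp [qi, qj]
      norm_num
    rw [h, this, one_smul, map_add, map_mul, map_one, map_ofNat]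
    noncomm_ring

/-- Every Hurwitz quaternion of norm divisible by `p` has a left divisor in `A'_p`. -/
theorem exists_factor_genA' {p : ℕ} (hp : p.Prime) (hp2 : p ≠ 2) {y : ℍ[ℚ]} (hy : y ∈ hurwitz)
    {n : ℤ} (hn : Quaternion.normSq y = p * n) : ∃ x ∈ genA' p, ∃ z ∈ hurwitz, y = x * z := by
  obtain ⟨x, hx, hxp, z, hz, rfl⟩ := exists_factor hp hy hn
  obtain ⟨e, he, he1, w, hw, hew⟩ := exists_unit_congr hx (n := p) (by simpa using hxp)
    (by exact_mod_cast hp.odd_of_ne_two hp2)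
  have hee : star e * e = 1 := by rw [Quaternion.star_mul_self, he1]; simp
  have hee' : e * star e = 1 := by rw [Quaternion.self_mul_star, he1]; simp
  -- As `x ≡ e` modulo `2𝒜` and `e ē = 1`, the product `x ē` is congruent to 1.
  have hA : x * star e ∈ genA p := by
    refine ⟨mul_mem_hurwitz hx (star_mem_hurwitz he), by simp [hxp, he1], ?_⟩
    refine psiTrivial_of_congr (mul_mem_hurwitz hw (star_mem_hurwitz he)) ?_
    rw [← mul_assoc, ← hew, sub_mul, hee']
    abel
  by_cases h4 : p % 4 = 1
  · refine ⟨x * star e, by rwa [genA', if_pos h4], e * z, mul_mem_hurwitz he hz, ?_⟩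
    rw [mul_assoc, ← mul_assoc (star e), hee, one_mul]
  · refine ⟨x * star e * qi ℚ, by rw [genA', if_neg h4]; exact ⟨_, hA, rfl⟩,
      star (qi ℚ) * (e * z), mul_mem_hurwitz (star_mem_hurwitz qi_mem_hurwitz)
        (mul_mem_hurwitz he hz), ?_⟩
    have hii : qi ℚ * star (qi ℚ) = 1 := by
      rw [Quaternion.self_mul_star]
      simp [Quaternion.normSq_def', qi]
    calc x * z = x * (star e * e) * z := by rw [hee, mul_one]
      _ = x * star e * 1 * (e * z) := by noncomm_ring
      _ = _ := by rw [← hii]; noncomm_ring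

/-- The integral quaternions that are congruent to `1` or to `1 + j + k` modulo `2`. -/
def IsPrincipalLipschitz (x : ℍ[ℚ]) : Prop :=
  ∃ a b c d : ℤ, x = quat (a : ℚ) b c d ∧ Odd a ∧ Even b ∧ Even (c + d)

theorem IsPrincipalLipschitz.one : IsPrincipalLipschitz 1 :=
  ⟨1, 0, 0, 0, by ext <;> simp, by simp, by simp, by simp⟩

/-- Modulo 2 the square of `1 + j + k` is 1. The witnesses are the coordinates of the product, with
the parity conditions solved for parameters. -/
theorem IsPrincipalLipschitz.mul {x y : ℍ[ℚ]} (hx : IsPrincipalLipschitz x)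
    (hy : IsPrincipalLipschitz y) : IsPrincipalLipschitz (x * y) := by
  obtain ⟨_, _, c, d, rfl, ⟨α, rfl⟩, ⟨β, rfl⟩, ⟨δ, hδ⟩⟩ := hx
  obtain ⟨_, _, C, D, rfl, ⟨A, rfl⟩, ⟨B, rfl⟩, ⟨E, hE⟩⟩ := hy
  obtain rfl : d = δ + δ - c := by omega
  obtain rfl : D = E + E - C := by omega
  refine ⟨2 * (2 * α * A + α + A - 2 * β * B - c * C - 2 * δ * E + δ * C + c * E) + 1,
    ((2 * α + 1) * B + β * (2 * A + 1) + c * E - δ * C) +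
      ((2 * α + 1) * B + β * (2 * A + 1) + c * E - δ * C),
    (2 * α + 1) * C - 2 * β * (2 * E - C) + c * (2 * A + 1) + (2 * δ - c) * (2 * B),
    (2 * α + 1) * (2 * E - C) + 2 * β * C - c * (2 * B) + (2 * δ - c) * (2 * A + 1),
    ?_, ⟨_, rfl⟩, ⟨_, rfl⟩,
    ⟨(2 * α + 1) * E + (2 * A + 1) * δ + 2 * β * (C - E) + 2 * B * (δ - c), by ring⟩⟩
  ext <;> simp <;> ring

theorem IsPrincipalLipschitz.star {x : ℍ[ℚ]} (hx : IsPrincipalLipschitz x) :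
    IsPrincipalLipschitz (star x) := by
  obtain ⟨a, b, c, d, rfl, ha, hb, hcd⟩ := hx
  refine ⟨a, -b, -c, -d, ?_, ha, hb.neg, ?_⟩
  · ext <;> simp
  · rw [← neg_add]
    exact hcd.neg

theorem IsPrincipalLipschitz.spec {x : ℍ[ℚ]} (hx : IsPrincipalLipschitz x) :
    x ∈ lipschitz ∧ ∃ r ∈ ({1, 1 + qj ℚ + qk ℚ} : Set ℍ[ℚ]),
      ∃ z ∈ lipschitz, x - r = 2 * z := by
  have h2 : ∀ z : ℍ[ℚ], 2 * z = (2 : ℚ) • z := fun z => by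
    simpa using natCast_mul_eq_smul 2 z
  simp only [h2]
  obtain ⟨a, b, c, d, rfl, ⟨α, rfl⟩, ⟨β, rfl⟩, hcd⟩ := hx
  refine ⟨mem_lipschitz.2 ⟨_, _, _, _, rfl⟩, ?_⟩
  rcases c.even_or_odd' with ⟨γ, rfl | rfl⟩ <;> rcases d.even_or_odd' with ⟨δ, rfl | rfl⟩
  · refine ⟨1, by simp, _, mem_lipschitz.2 ⟨α, β, γ, δ, rfl⟩, ?_⟩
    ext <;> simp <;> ring
  · rw [Int.even_iff] at hcd
    omega
  · rw [Int.even_iff] at hcd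
    omega
  · refine ⟨1 + qj ℚ + qk ℚ, by simp, _, mem_lipschitz.2 ⟨α, β, γ, δ, rfl⟩, ?_⟩
    ext <;> simp [qj, qk] <;> ring

/-- A non-integral `s` is impossible, since the leading term would dominate. Modulo 4, `s` must then
be odd, so `s² = 1` and `t s = p + 1`, which determines `t`. -/
theorem padic_two_quadratic {p t : ℤ} (hp : Odd p) {s : ℚ_[2]}
    (h : ‖(p : ℚ_[2]) * s ^ 2 - t * s + 1‖ ≤ 1 / 4) :
    (p % 4 = 1 ∧ t % 4 = 2) ∨ (p % 4 = 3 ∧ t % 4 = 0) := by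
  have hp1 : ‖(p : ℚ_[2])‖ = 1 := by
    refine le_antisymm (Padic.norm_int_le_one p) (not_lt.1 fun hlt => ?_)
    rw [Padic.norm_intCast_lt_one_iff] at hlt
    exact Int.not_even_iff_odd.2 hp (even_iff_two_dvd.2 (by exact_mod_cast hlt))
  have hs : ‖s‖ ≤ 1 := by
    by_contra! hs
    have h1 : ‖(p : ℚ_[2]) * s ^ 2‖ ≤ ‖s‖ := by
      calc ‖(p : ℚ_[2]) * s ^ 2‖ = ‖((p : ℚ_[2]) * s ^ 2 - t * s + 1) + (t * s + (-1))‖ := by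
            ring_nf
        _ ≤ max _ _ := Padic.nonarchimedean _ _
        _ ≤ ‖s‖ := by
          refine max_le (by linarith) ((Padic.nonarchimedean _ _).trans (max_le ?_ ?_))
          · rw [norm_mul]
            exact mul_le_of_le_one_left (norm_nonneg _) (Padic.norm_int_le_one t)
          · simpa using hs.le
    rw [norm_mul, hp1, norm_pow] at h1
    nlinarith
  obtain ⟨s, rfl⟩ : ∃ r : ℤ_[2], (r : ℚ_[2]) = s := ⟨⟨s, hs⟩, rfl⟩
  have h2 : PadicInt.toZModPow (p := 2) 2 (Int.cast p * s ^ 2 - Int.cast t * s + 1) = 0 := by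
    rw [← RingHom.mem_ker, PadicInt.ker_toZModPow, ← PadicInt.norm_le_pow_iff_mem_span_pow]
    norm_num
    rw [PadicInt.norm_def]
    push_cast
    norm_num at h ⊢
    exact h
  simp only [map_add, map_sub, map_mul, map_pow, map_intCast, map_one] at h2
  have key : ∀ P T s : ZMod (2 ^ 2), P * s ^ 2 - T * s + 1 = 0 →
      (P = 1 → T = 2) ∧ (P = 3 → T = 0) := by decide
  obtain ⟨k1, k3⟩ := key _ _ _ h2
  have e : ∀ a b : ℤ, (a : ZMod (2 ^ 2)) = b ↔ a % 4 = b % 4 := fun a b => by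
    rw [ZMod.intCast_eq_intCast_iff]; rfl
  have hodd := Int.odd_iff.1 hp
  rcases (by omega : p % 4 = 1 ∨ p % 4 = 3) with h4 | h4
  · exact Or.inl ⟨h4, (e t 2).1 (by push_cast; exact k1 (by simpa using (e p 1).2 h4))⟩
  · exact Or.inr ⟨h4, (e t 0).1 (by push_cast; exact k3 (by simpa using (e p 3).2 h4))⟩

/-- If `x = c u` with `u ∈ 1 + 2𝔒₂` and `s = c⁻¹`, then `s x - 1` lies in `2𝔒₂`, and its norm `p s²
- t s + 1` is divisible by 4. -/
theorem psiTrivial_norm {x : ℍ[ℚ]} {p t : ℤ} (h : PsiTrivial x)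
    (hp : Quaternion.normSq x = p) (ht : 2 * x.re = t) :
    ∃ s : ℚ_[2], ‖(p : ℚ_[2]) * s ^ 2 - t * s + 1‖ ≤ 1 / 4 := by
  obtain ⟨c, hc, _, ⟨y, hy, rfl⟩, hx⟩ := h
  refine ⟨c⁻¹, ?_⟩
  have h1 : c⁻¹ • toPadic 2 x + (-1) = (-2 : ℚ_[2]) • y := by
    rw [hx, smul_smul, inv_mul_cancel₀ hc, one_smul]
    have : (qi ℚ_[2] - qj ℚ_[2]) ^ 2 = ((-2 : ℚ_[2]) : ℍ[ℚ_[2]]) := by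
      rw [pow_two]
      ext <;> simp [qi, qj]
      norm_num
    rw [this, Quaternion.coe_mul_eq_smul]
    abel
  have h2 := congrArg Quaternion.normSq h1
  rw [Quaternion.normSq_smul, Quaternion.normSq_add, Quaternion.normSq_smul, normSq_toPadic,
    hp] at h2
  have h3 : (toPadic 2 x).re = algebraMap ℚ ℚ_[2] x.re := rfl
  have h4 : 2 * (toPadic 2 x).re = t := by
    have := congrArg (algebraMap ℚ ℚ_[2]) ht
    rw [map_mul, map_intCast, map_ofNat] at this
    rwa [h3]
  have h5 : (p : ℚ_[2]) * c⁻¹ ^ 2 - t * c⁻¹ + 1 = 4 * Quaternion.normSq y := by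
    rw [← h4]
    simp at h2
    linear_combination h2
  rw [h5, norm_mul]
  have h6 : ‖(4 : ℚ_[2])‖ = 1 / 4 := by
    have : (4 : ℚ_[2]) = ((2 : ℕ) : ℚ_[2]) ^ 2 := by norm_num
    rw [this, norm_pow, Padic.norm_p]
    norm_num
  rw [h6]
  have : ‖Quaternion.normSq y‖ ≤ 1 := hy
  linarith

/-- The trace is even, so `x ∈ A_p` has integral coordinates, with real part odd if `p ≡ 1` and even
if `p ≡ 3` modulo 4. The norm modulo 4 then forces the other three coordinates to be all even,
respectively all odd. In the second case multiplication by `i` makes the real part odd and the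
`i`-coordinate even. -/
theorem isPrincipalLipschitz_of_mem_genA' {p : ℕ} (hp : Odd p) {x : ℍ[ℚ]} (hx : x ∈ genA' p) :
    IsPrincipalLipschitz x := by
  have key : ∀ x ∈ genA p, ∃ a b c d : ℤ, x = quat (a : ℚ) b c d ∧
      ((p % 4 = 1 ∧ Odd a ∧ Even b ∧ Even (c + d)) ∨
        (p % 4 = 3 ∧ Odd b ∧ Even a ∧ Even (c + d))) := by
    rintro x ⟨hx, hxp, hψ⟩
    obtain ⟨a, b, c, d, rfl⟩ := mem_hurwitz.1 hx
    obtain ⟨s, hs⟩ := psiTrivial_norm hψ (p := p) (t := 2 * a + d) (by simpa using hxp)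
      (by simp; ring)
    have h := padic_two_quadratic (by exact_mod_cast hp) hs
    obtain ⟨k, rfl⟩ : ∃ k, d = 2 * k := ⟨d / 2, by omega⟩
    have hN : ((a + k) ^ 2 + (b + k) ^ 2 + (c + k) ^ 2 + k ^ 2 : ℤ) = p := by
      simp only [Quaternion.normSq_def', quat_re, quat_imI, quat_imJ, quat_imK] at hxp
      push_cast at hxp
      have : ((a + k) ^ 2 + (b + k) ^ 2 + (c + k) ^ 2 + k ^ 2 : ℚ) = p := by
        linear_combination hxp
      exact_mod_cast this
    refine ⟨a + k, b + k, c + k, k, by ext <;> simp, ?_⟩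
    obtain ⟨A, hA⟩ : ∃ A, A = a + k := ⟨_, rfl⟩
    obtain ⟨B, hB⟩ : ∃ B, B = b + k := ⟨_, rfl⟩
    obtain ⟨C, hC⟩ : ∃ C, C = c + k := ⟨_, rfl⟩
    rw [← hA, ← hB, ← hC] at hN ⊢
    have sq : ∀ m : ℤ, (m % 2 = 0 ∧ m ^ 2 % 4 = 0) ∨ (m % 2 = 1 ∧ m ^ 2 % 4 = 1) := fun m => by
      rcases Int.emod_two_eq_zero_or_one m with h | h
      · obtain ⟨r, rfl⟩ := Int.dvd_of_emod_eq_zero h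
        left
        ring_nf
        omega
      · obtain ⟨r, rfl⟩ : ∃ r, m = 2 * r + 1 := ⟨m / 2, by omega⟩
        right
        ring_nf
        omega
    simp only [Int.odd_iff, Int.even_iff]
    have := sq A; have := sq B; have := sq C; have := sq k
    omega
  by_cases h4 : p % 4 = 1
  · rw [genA', if_pos h4] at hx
    obtain ⟨a, b, c, d, rfl, h⟩ := key x hx
    exact ⟨a, b, c, d, rfl, h.elim (fun h => h.2) fun h => absurd h.1 (by omega)⟩
  · rw [genA', if_neg h4] at hx
    obtain ⟨y, hy, rfl⟩ := hx
    obtain ⟨a, b, c, d, rfl, h⟩ := key y hy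
    obtain ⟨-, ha, hb, hcd⟩ : p % 4 = 3 ∧ Odd b ∧ Even a ∧ Even (c + d) := by tauto
    refine ⟨-b, a, d, -c, by ext <;> simp [qi], ha.neg, hb, ?_⟩
    simpa [parity_simps, iff_comm] using hcd

theorem normSq_of_mem_genA' {p : ℕ} {x : ℍ[ℚ]} (hx : x ∈ genA' p) :
    Quaternion.normSq x = p := by
  rw [genA'] at hx
  split_ifs at hx
  · exact hx.2.1
  · obtain ⟨y, hy, rfl⟩ := hx
    simp [hy.2.1, Quaternion.normSq_def' (quat _ _ _ _), qi]

theorem mem_hurwitz_of_mem_genA' {p : ℕ} {x : ℍ[ℚ]} (hx : x ∈ genA' p) : x ∈ hurwitz := by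
  rw [genA'] at hx
  split_ifs at hx
  · exact hx.1
  · obtain ⟨y, hy, rfl⟩ := hx
    exact mul_mem_hurwitz hy.1 qi_mem_hurwitz

/-! ### Units of `𝒜(ℤ_S)` and integral representatives -/

variable {S : Set Place}

theorem mem_hurwitzS {x : ℍ[ℚ]} (hx : x ∈ hurwitz) : x ∈ hurwitzS S :=
  Algebra.subset_adjoin hx

/-- `n` is a product of primes of `S`. -/
def IsSNumber (S : Set Place) (n : ℕ) : Prop :=
  n ≠ 0 ∧ ∀ q : Nat.Primes, q.1 ∣ n → Place.finite q ∈ S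

theorem IsSNumber.inv_mem {n : ℕ} (hn : IsSNumber S n) : (n : ℚ)⁻¹ ∈ sIntegers S := by
  intro q hq
  refine hn.2 q (hq.trans ?_)
  rw [Rat.inv_natCast_den_of_pos (Nat.pos_of_ne_zero hn.1)]

theorem IsSNumber.mul {m n : ℕ} (hm : IsSNumber S m) (hn : IsSNumber S n) :
    IsSNumber S (m * n) :=
  ⟨mul_ne_zero hm.1 hn.1, fun q hq => (q.2.dvd_mul.1 hq).elim (hm.2 q) (hn.2 q)⟩

/-- A Hurwitz quaternion whose norm is a product of primes of `S`, as a unit of `𝒜(ℤ_S)`. -/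
theorem exists_unit {x : ℍ[ℚ]} (hx : x ∈ hurwitz) {n : ℕ} (hn : IsSNumber S n)
    (hxn : Quaternion.normSq x = n) : ∃ u : (hurwitzS S)ˣ, ((u : hurwitzS S) : ℍ[ℚ]) = x ∧
      (((u⁻¹ : (hurwitzS S)ˣ) : hurwitzS S) : ℍ[ℚ]) = (n : ℚ)⁻¹ • star x := by
  have hn0 : (n : ℚ) ≠ 0 := by exact_mod_cast hn.1
  let v : hurwitzS S := (⟨(n : ℚ)⁻¹, hn.inv_mem⟩ : sIntegers S) •
    ⟨star x, mem_hurwitzS (star_mem_hurwitz hx)⟩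
  have hv : (v : ℍ[ℚ]) = (n : ℚ)⁻¹ • star x := rfl
  refine ⟨⟨⟨x, mem_hurwitzS hx⟩, v, ?_, ?_⟩, rfl, hv⟩
  · ext1
    change x * (v : ℍ[ℚ]) = 1
    rw [hv, mul_smul_comm, Quaternion.self_mul_star, hxn, Quaternion.smul_coe,
      inv_mul_cancel₀ hn0, Quaternion.coe_one]
  · ext1
    change (v : ℍ[ℚ]) * x = 1
    rw [hv, smul_mul_assoc, Quaternion.star_mul_self, hxn, Quaternion.smul_coe,
      inv_mul_cancel₀ hn0, Quaternion.coe_one]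

theorem mk_eq_mk {u v : (hurwitzS S)ˣ} {q : ℚ} (hq0 : q ≠ 0) (hq : q ∈ sIntegers S)
    (hq' : q⁻¹ ∈ sIntegers S) (h : ((u : hurwitzS S) : ℍ[ℚ]) = q • ((v : hurwitzS S) : ℍ[ℚ])) :
    (u : Lambda S) = v := by
  let c : (sIntegers S)ˣ := ⟨⟨q, hq⟩, ⟨q⁻¹, hq'⟩, Subtype.ext (mul_inv_cancel₀ hq0),
    Subtype.ext (inv_mul_cancel₀ hq0)⟩
  obtain ⟨w, hw, hwq⟩ : ∃ w ∈ scalarUnits S, ((w : hurwitzS S) : ℍ[ℚ]) = (q : ℍ[ℚ]) :=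
    ⟨Units.map (algebraMap (sIntegers S) (hurwitzS S)).toMonoidHom c, ⟨c, rfl⟩, rfl⟩
  have huv : u = w * v := by
    ext1
    ext1
    rw [h, ← Quaternion.coe_mul_eq_smul]
    exact (congrArg (· * ((v : hurwitzS S) : ℍ[ℚ])) hwq).symm
  rw [huv, QuotientGroup.mk_mul, (QuotientGroup.eq_one_iff _).2 hw, one_mul]

theorem natCast_mem_sIntegers (n : ℕ) : (n : ℚ) ∈ sIntegers S := natCast_mem _ n

/-- The norm is `a²`, so all primes dividing `a` lie in `S` and `a` is a unit of `ℤ_S`. -/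
theorem mk_eq_one_of_real {u : (hurwitzS S)ˣ} {a : ℤ} {n : ℕ} (hn : IsSNumber S n)
    (hu : ((u : hurwitzS S) : ℍ[ℚ]) = quat (a : ℚ) 0 0 0)
    (hun : Quaternion.normSq ((u : hurwitzS S) : ℍ[ℚ]) = n) : (u : Lambda S) = 1 := by
  have han : a.natAbs ^ 2 = n := by
    rw [hu] at hun
    have : (a : ℚ) ^ 2 = n := by simpa [Quaternion.normSq_def'] using hun
    zify
    rw [sq_abs]
    exact_mod_cast this
  have ha : IsSNumber S a.natAbs := by
    refine ⟨fun h => hn.1 (by rw [← han, h]; rfl), fun q hq => hn.2 q ?_⟩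
    rw [← han]
    exact hq.trans (dvd_pow_self _ two_ne_zero)
  have ha0 : (a : ℚ) ≠ 0 := by
    have := ha.1
    exact_mod_cast Int.natAbs_ne_zero.1 this
  have hinv : (a : ℚ)⁻¹ ∈ sIntegers S := by
    rcases Int.natAbs_eq a with h | h
    · rw [h]
      simpa using ha.inv_mem
    · rw [h]
      simpa [inv_neg] using ha.inv_mem
  refine mk_eq_mk (v := 1) ha0 (intCast_mem _ a) hinv ?_
  rw [hu]
  ext <;> simp

theorem isSNumber_and_ne_two {p : unramified S} : IsSNumber S p.1.1 ∧ p.1.1 ≠ 2 := by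
  refine ⟨⟨p.1.2.ne_zero, fun q hq => ?_⟩, fun h => p.2.2 (Or.inl ?_)⟩
  · have : q = p.1 := Subtype.ext ((Nat.prime_dvd_prime_iff_eq q.2 p.1.2).1 hq)
    exact this ▸ p.2.1
  · have : p.1 = ⟨2, Nat.prime_two⟩ := Subtype.ext h
    rw [this]
    rfl

/-- `u` is an integral representative, congruent to `1` or `1 + j + k` modulo `2`, whose norm is a
product of primes of `S`. -/
def IsGoodUnit (u : (hurwitzS S)ˣ) : Prop :=
  IsPrincipalLipschitz ((u : hurwitzS S) : ℍ[ℚ]) ∧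
    ∃ n, IsSNumber S n ∧ Quaternion.normSq ((u : hurwitzS S) : ℍ[ℚ]) = n

theorem exists_unit_of_mem_genA' {p : unramified S} {x : ℍ[ℚ]} (hx : x ∈ genA' p.1.1) :
    ∃ u : (hurwitzS S)ˣ, ((u : hurwitzS S) : ℍ[ℚ]) = x ∧
      (((u⁻¹ : (hurwitzS S)ˣ) : hurwitzS S) : ℍ[ℚ]) = (p.1.1 : ℚ)⁻¹ • star x ∧
      (u : Lambda S) ∈ Gamma' S := by
  obtain ⟨u, hu, hu'⟩ := exists_unit (mem_hurwitz_of_mem_genA' hx) isSNumber_and_ne_two.1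
    (normSq_of_mem_genA' hx)
  exact ⟨u, hu, hu', Subgroup.subset_closure
    (Set.mem_biUnion p.2 (show _ ∈ genPA' S p.1.1 from ⟨u, hu ▸ hx, rfl⟩))⟩

/-- The inverse of `u` is `n⁻¹ ū`, and the scalar dies in `Λ_S`; the conjugate therefore represents
the inverse class without denominators. -/
theorem exists_isGoodUnit {γ : Lambda S} (hγ : γ ∈ Gamma' S) :
    ∃ u : (hurwitzS S)ˣ, (u : Lambda S) = γ ∧ IsGoodUnit u := by
  induction hγ using Subgroup.closure_induction with
  | mem γ h =>
    obtain ⟨p, hp, u, hu, rfl⟩ := Set.mem_iUnion₂.1 h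
    have := isSNumber_and_ne_two (p := ⟨p, hp⟩)
    exact ⟨u, rfl, isPrincipalLipschitz_of_mem_genA' (p.2.odd_of_ne_two this.2) hu, p.1, this.1,
      normSq_of_mem_genA' hu⟩
  | one =>
    exact ⟨1, rfl, .one, 1, ⟨one_ne_zero, fun q hq => absurd (Nat.dvd_one.1 hq) q.2.ne_one⟩,
      by simp⟩
  | mul _ _ _ _ h1 h2 =>
    obtain ⟨u, rfl, hu, m, hm, hum⟩ := h1
    obtain ⟨v, rfl, hv, n, hn, hvn⟩ := h2
    refine ⟨u * v, rfl, hu.mul hv, m * n, hm.mul hn, ?_⟩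
    simp [hum, hvn]
  | inv _ _ h =>
    obtain ⟨u, rfl, hu, n, hn, hun⟩ := h
    have hA : star ((u : hurwitzS S) : ℍ[ℚ]) ∈ hurwitz := by
      obtain ⟨a, b, c, d, h, -⟩ := hu.star
      rw [h]
      exact quat_int_mem_hurwitz a b c d
    have hn0 : (n : ℚ) ≠ 0 := by exact_mod_cast hn.1
    obtain ⟨v, hv, hv'⟩ := exists_unit hA hn (by rw [Quaternion.normSq_star, hun])
    refine ⟨v, ?_, by
      rw [IsGoodUnit, hv]
      exact ⟨hu.star, n, hn, by rw [Quaternion.normSq_star, hun]⟩⟩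
    rw [eq_comm, inv_eq_iff_eq_inv, ← QuotientGroup.mk_inv, eq_comm]
    refine mk_eq_mk (inv_ne_zero hn0) hn.inv_mem (by rw [inv_inv]; exact natCast_mem_sIntegers n) ?_
    rw [hv', star_star]

/-! ### The local order at an odd prime and its stable lattice -/

section Local

variable {p : ℕ} [Fact p.Prime]

variable (p) in
/-- The order `ℤ_p ⊕ ℤ_p i ⊕ ℤ_p j ⊕ ℤ_p k` of `ℍ[ℚ_p]`. -/
noncomputable def padicOrder : Subring ℍ[ℚ_[p]] := (baseChange (algebraMap ℤ_[p] ℚ_[p])).range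

theorem mem_padicOrder {x : ℍ[ℚ_[p]]} :
    x ∈ padicOrder p ↔ ‖x.re‖ ≤ 1 ∧ ‖x.imI‖ ≤ 1 ∧ ‖x.imJ‖ ≤ 1 ∧ ‖x.imK‖ ≤ 1 := by
  constructor
  · rintro ⟨y, rfl⟩
    exact ⟨PadicInt.norm_le_one _, PadicInt.norm_le_one _, PadicInt.norm_le_one _,
      PadicInt.norm_le_one _⟩
  · rintro ⟨h1, h2, h3, h4⟩
    exact ⟨⟨⟨_, h1⟩, ⟨_, h2⟩, ⟨_, h3⟩, ⟨_, h4⟩⟩, rfl⟩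

theorem star_mem_padicOrder {x : ℍ[ℚ_[p]]} (hx : x ∈ padicOrder p) : star x ∈ padicOrder p := by
  simpa [mem_padicOrder] using hx

theorem smul_mem_padicOrder {c : ℚ_[p]} (hc : ‖c‖ ≤ 1) {x : ℍ[ℚ_[p]]} (hx : x ∈ padicOrder p) :
    c • x ∈ padicOrder p := by
  simp only [mem_padicOrder, Quaternion.re_smul, Quaternion.imI_smul, Quaternion.imJ_smul,
    Quaternion.imK_smul, smul_eq_mul, norm_mul] at *
  exact ⟨mul_le_one₀ hc (norm_nonneg _) hx.1, mul_le_one₀ hc (norm_nonneg _) hx.2.1,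
    mul_le_one₀ hc (norm_nonneg _) hx.2.2.1, mul_le_one₀ hc (norm_nonneg _) hx.2.2.2⟩

theorem norm_normSq_le_one {x : ℍ[ℚ_[p]]} (hx : x ∈ padicOrder p) :
    ‖Quaternion.normSq x‖ ≤ 1 := by
  obtain ⟨y, rfl⟩ := hx
  have : Quaternion.normSq (baseChange (algebraMap ℤ_[p] ℚ_[p]) y)
      = ((Quaternion.normSq y : ℤ_[p]) : ℚ_[p]) := by
    simp only [Quaternion.normSq_def']
    push_cast
    rfl
  rw [this]
  exact PadicInt.norm_le_one _

theorem norm_two_eq_one (hp : p ≠ 2) : ‖(2 : ℚ_[p])‖ = 1 := by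
  refine le_antisymm (by simpa using Padic.norm_int_le_one (p := p) 2) (not_lt.1 fun hlt => ?_)
  have h : ‖((2 : ℕ) : ℚ_[p])‖ < 1 := by simpa using hlt
  rw [Padic.norm_natCast_lt_one_iff] at h
  exact hp ((Nat.prime_dvd_prime_iff_eq Fact.out Nat.prime_two).1 h)

theorem toPadic_mem_padicOrder (hp : p ≠ 2) {x : ℍ[ℚ]} (hx : x ∈ hurwitz) :
    toPadic p x ∈ padicOrder p := by
  obtain ⟨a, b, c, d, rfl⟩ := mem_hurwitz.1 hx
  have key : ∀ m : ℤ, ‖(algebraMap ℚ ℚ_[p]) ((m : ℚ) / 2)‖ ≤ 1 := fun m => by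
    rw [map_div₀, norm_div, map_ofNat, norm_two_eq_one hp, div_one, map_intCast]
    exact Padic.norm_int_le_one m
  have key2 : ∀ m n : ℤ, ‖(algebraMap ℚ ℚ_[p]) (m + (n : ℚ) / 2)‖ ≤ 1 := fun m n => by
    have := key (2 * m + n)
    convert this using 3
    push_cast
    ring
  exact mem_padicOrder.2 ⟨key2 _ _, key2 _ _, key2 _ _, key d⟩

/-- By Cayley–Hamilton, a 2 × 2 matrix whose square is scalar is itself scalar unless its trace
vanishes. -/
theorem trace_eq_zero_of_sq (φ : Splitting p) {y : ℍ[ℚ_[p]]} (hy : y * y = -1)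
    (hne : ∀ c : ℚ_[p], y ≠ algebraMap _ _ c) : (φ y).trace = 0 := by
  have h : φ y * φ y = -1 := by rw [← map_mul, hy, map_neg, map_one]
  by_contra htr
  rw [Matrix.trace_fin_two] at htr
  have h00 := congrFun (congrFun h 0) 0
  have h01 := congrFun (congrFun h 0) 1
  have h10 := congrFun (congrFun h 1) 0
  have h11 := congrFun (congrFun h 1) 1
  simp [Matrix.mul_apply, Fin.sum_univ_two] at h00 h01 h10 h11
  have e01 : φ y 0 1 = 0 :=
    (mul_eq_zero.1 (show φ y 0 1 * (φ y 0 0 + φ y 1 1) = 0 by linear_combination h01)).resolve_right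
      htr
  have e10 : φ y 1 0 = 0 :=
    (mul_eq_zero.1 (show φ y 1 0 * (φ y 0 0 + φ y 1 1) = 0 by linear_combination h10)).resolve_right
      htr
  have e : φ y 0 0 - φ y 1 1 = 0 :=
    (mul_eq_zero.1 (show (φ y 0 0 - φ y 1 1) * (φ y 0 0 + φ y 1 1) = 0 by
      linear_combination h00 - h11)).resolve_right htr
  refine hne (φ y 0 0) (φ.injective ?_)
  rw [AlgEquiv.commutes]
  ext i j
  fin_cases i <;> fin_cases j <;> simp [e01, e10, Matrix.algebraMap_matrix_apply]
  linear_combination -e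

/-- By linearity it is enough that `i`, `j`, `k` have trace zero in any splitting, so Skolem–Noether
is not needed. -/
theorem trace_splitting (φ : Splitting p) (x : ℍ[ℚ_[p]]) : (φ x).trace = 2 * x.re := by
  have hx : x = x.re • 1 + x.imI • qi _ + x.imJ • qj _ + x.imK • qk _ := by
    ext <;> simp [qi, qj, qk]
  have hi := trace_eq_zero_of_sq φ (y := qi _) (by ext <;> simp [qi])
    (fun c hc => one_ne_zero (congrArg (fun q : ℍ[ℚ_[p]] => q.imI) hc))
  have hj := trace_eq_zero_of_sq φ (y := qj _) (by ext <;> simp [qj])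
    (fun c hc => one_ne_zero (congrArg (fun q : ℍ[ℚ_[p]] => q.imJ) hc))
  have hk := trace_eq_zero_of_sq φ (y := qk _) (by ext <;> simp [qk])
    (fun c hc => one_ne_zero (congrArg (fun q : ℍ[ℚ_[p]] => q.imK) hc))
  conv_lhs => rw [hx]
  simp [hi, hj, hk, mul_comm]

/-- The lattice `φ(𝒪) e₁ + φ(𝒪) e₂` is the image of this map. -/
noncomputable def orderMap (φ : Splitting p) :
    ℍ[ℤ_[p]] × ℍ[ℤ_[p]] →ₗ[ℤ_[p]] (Fin 2 → ℚ_[p]) where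
  toFun x := (φ (baseChange (algebraMap ℤ_[p] ℚ_[p]) x.1)).mulVec (Pi.single 0 1) +
    (φ (baseChange (algebraMap ℤ_[p] ℚ_[p]) x.2)).mulVec (Pi.single 1 1)
  map_add' x y := by
    simp only [Prod.fst_add, Prod.snd_add, map_add, Matrix.add_mulVec]
    abel
  map_smul' c x := by
    have h : ∀ y : ℍ[ℤ_[p]], baseChange (algebraMap ℤ_[p] ℚ_[p]) (c • y)
        = (c : ℚ_[p]) • baseChange (algebraMap ℤ_[p] ℚ_[p]) y := fun y => by
      ext <;> simp [baseChange]
    simp only [Prod.smul_fst, Prod.smul_snd, h, map_smul, Matrix.smul_mulVec, RingHom.id_apply,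
      smul_add]
    rfl

theorem mulVec_orderMap (φ : Splitting p) (h : ℍ[ℤ_[p]]) (x : ℍ[ℤ_[p]] × ℍ[ℤ_[p]]) :
    (φ (baseChange (algebraMap ℤ_[p] ℚ_[p]) h)).mulVec (orderMap φ x)
      = orderMap φ (h * x.1, h * x.2) := by
  simp only [orderMap, LinearMap.coe_mk, AddHom.coe_mk, Matrix.mulVec_add, Matrix.mulVec_mulVec,
    map_mul]

/-- A lattice that is stable under the order. -/
noncomputable def stableLattice (φ : Splitting p) : PadicLattice p :=
  ⟨LinearMap.range (orderMap φ), by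
    constructor
    · exact Submodule.FG.map _ Module.Finite.fg_top |> (by rw [LinearMap.range_eq_map]; exact ·)
    · rw [eq_top_iff]
      intro v _
      have h0 : (Pi.single 0 1 : Fin 2 → ℚ_[p]) ∈ LinearMap.range (orderMap φ) :=
        ⟨(1, 0), by simp only [orderMap, LinearMap.coe_mk, AddHom.coe_mk, map_one, map_zero,
          Matrix.one_mulVec, Matrix.zero_mulVec, add_zero]⟩
      have h1 : (Pi.single 1 1 : Fin 2 → ℚ_[p]) ∈ LinearMap.range (orderMap φ) :=
        ⟨(0, 1), by simp only [orderMap, LinearMap.coe_mk, AddHom.coe_mk, map_one, map_zero,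
          Matrix.one_mulVec, Matrix.zero_mulVec, zero_add]⟩
      have hv : v = v 0 • (Pi.single 0 1 : Fin 2 → ℚ_[p]) +
          v 1 • (Pi.single 1 1 : Fin 2 → ℚ_[p]) := by
        ext i
        fin_cases i <;> simp
      rw [hv]
      exact add_mem (Submodule.smul_mem _ _ (Submodule.subset_span h0))
        (Submodule.smul_mem _ _ (Submodule.subset_span h1))⟩

theorem mulVec_mem_stableLattice (φ : Splitting p) {h : ℍ[ℚ_[p]]} (hh : h ∈ padicOrder p)
    {v : Fin 2 → ℚ_[p]} (hv : v ∈ (stableLattice φ).1) : (φ h).mulVec v ∈ (stableLattice φ).1 := by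
  obtain ⟨h, rfl⟩ := hh
  obtain ⟨x, rfl⟩ := hv
  exact ⟨_, (mulVec_orderMap φ h x).symm⟩

theorem mem_smul_lattice {g : (Mat p)ˣ} {L : PadicLattice p} {v : Fin 2 → ℚ_[p]} :
    v ∈ (g • L).1 ↔ ∃ w ∈ L.1, (g : Mat p).mulVec w = v := Iff.rfl

/-- A lattice is free of rank 2 over `ℤ_p`; a basis gives `g` with `L = g ℤ_p²`. -/
theorem exists_coordinates (L : PadicLattice p) :
    ∃ g : (Mat p)ˣ, ∀ v, v ∈ L.1 ↔ ∀ i, ‖((g⁻¹ : (Mat p)ˣ) : Mat p).mulVec v i‖ ≤ 1 := by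
  have := L.2
  let b := Module.finBasisOfFinrankEq ℤ_[p] L.1
    ((Submodule.IsLattice.finrank_of_pi ℚ_[p] L.1).trans (Fintype.card_fin 2))
  let B := b.extendOfIsLattice ℚ_[p]
  have hB : ∀ i, B i = (b i : Fin 2 → ℚ_[p]) := fun i => by simp [B]
  let e := Pi.basisFun ℚ_[p] (Fin 2)
  refine ⟨⟨e.toMatrix B, B.toMatrix e, e.toMatrix_mul_toMatrix_flip B,
    B.toMatrix_mul_toMatrix_flip e⟩, fun v => ?_⟩
  have hr : (B.toMatrix e).mulVec v = B.repr v := by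
    have h := e.toMatrix_mulVec_repr B v
    have he : (e.repr v : Fin 2 → ℚ_[p]) = v := by
      ext i
      exact Pi.basisFun_repr _ _ _ _
    rwa [he] at h
  change _ ↔ ∀ i, ‖(B.toMatrix e).mulVec v i‖ ≤ 1
  rw [hr]
  constructor
  · intro hv i
    have h1 : v = ∑ j, ((b.repr ⟨v, hv⟩ j : ℤ_[p]) : ℚ_[p]) • B j := by
      have := congrArg Subtype.val (b.sum_repr ⟨v, hv⟩)
      simp only [Submodule.coe_sum, Submodule.coe_smul] at this
      refine this.symm.trans (Finset.sum_congr rfl fun j _ => ?_)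
      rw [hB]
      rfl
    have h2 : B.repr v i = ((b.repr ⟨v, hv⟩ i : ℤ_[p]) : ℚ_[p]) := by
      conv_lhs => rw [h1]
      rw [B.repr_sum_self]
    rw [h2]
    exact PadicInt.norm_le_one _
  · intro h
    rw [← B.sum_repr v]
    refine sum_mem fun i _ => ?_
    rw [hB]
    exact L.1.smul_mem ⟨_, h i⟩ (b i).2

theorem exists_smul_eq (L L' : PadicLattice p) : ∃ g : (Mat p)ˣ, g • L = L' := by
  obtain ⟨g, hg⟩ := exists_coordinates L
  obtain ⟨h, hh⟩ := exists_coordinates L'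
  refine ⟨h * g⁻¹, Subtype.ext (Submodule.ext fun v => ?_)⟩
  rw [mem_smul_lattice]
  constructor
  · rintro ⟨w, hw, rfl⟩
    rw [hh, Matrix.mulVec_mulVec, ← Units.val_mul, inv_mul_cancel_left]
    exact (hg w).1 hw
  · intro hv
    refine ⟨((g * h⁻¹ : (Mat p)ˣ) : Mat p).mulVec v, ?_, ?_⟩
    · rw [hg, Matrix.mulVec_mulVec, ← Units.val_mul, inv_mul_cancel_left]
      exact (hh v).1 hv
    · rw [Matrix.mulVec_mulVec, ← Units.val_mul]
      simp

theorem norm_trace_le_one {L : PadicLattice p} {M : Mat p} (hM : ∀ v ∈ L.1, M.mulVec v ∈ L.1) :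
    ‖M.trace‖ ≤ 1 := by
  obtain ⟨g, hg⟩ := exists_coordinates L
  have h : M.trace = (((g⁻¹ : (Mat p)ˣ) : Mat p) * (M * g)).trace := by
    rw [Matrix.trace_mul_comm, mul_assoc, Units.mul_inv, mul_one]
  have key : ∀ j, ‖(((g⁻¹ : (Mat p)ˣ) : Mat p) * (M * g)) j j‖ ≤ 1 := fun j => by
    have h1 : (g : Mat p).mulVec (Pi.single j 1) ∈ L.1 := by
      rw [hg, Matrix.mulVec_mulVec, Units.inv_mul, Matrix.one_mulVec]
      intro i
      by_cases hij : i = j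
      · subst hij; simp
      · simp [Pi.single_eq_of_ne hij]
    have h2 := (hg _).1 (hM _ h1) j
    rw [Matrix.mulVec_mulVec, Matrix.mulVec_mulVec] at h2
    simpa [mul_assoc] using h2
  rw [h, Matrix.trace_fin_two]
  exact (Padic.nonarchimedean _ _).trans (max_le (key 0) (key 1))

/-- The order is the full endomorphism ring of the lattice. -/
theorem mem_padicOrder_of_stable (hp : p ≠ 2) (φ : Splitting p) {x : ℍ[ℚ_[p]]}
    (hx : ∀ v ∈ (stableLattice φ).1, (φ x).mulVec v ∈ (stableLattice φ).1) : x ∈ padicOrder p := by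
  -- Stability passes from `x` to `x e`, so `2 Re(x e)` is integral. As 2 is a unit, `e = 1, i, j,
  -- k` give the coordinates of `x` up to sign.
  have key : ∀ e ∈ padicOrder p, ‖(x * e).re‖ ≤ 1 := fun e he => by
    have h : ‖(φ (x * e)).trace‖ ≤ 1 := norm_trace_le_one (L := stableLattice φ) fun v hv => by
      rw [map_mul, ← Matrix.mulVec_mulVec]
      exact hx _ (mulVec_mem_stableLattice φ he hv)
    rwa [trace_splitting, norm_mul, norm_two_eq_one hp, one_mul] at h
  have h1 := key 1 (one_mem _)
  have h2 := key (qi _) (mem_padicOrder.2 (by simp [qi]))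
  have h3 := key (qj _) (mem_padicOrder.2 (by simp [qj]))
  have h4 := key (qk _) (mem_padicOrder.2 (by simp [qk]))
  simp [qi, qj, qk] at h1 h2 h3 h4
  exact mem_padicOrder.2 ⟨h1, h2, h3, h4⟩

end Local

/-! ### Stabiliser and orbit of the base vertex -/

section Local

variable {p : ℕ} [Fact p.Prime]

/-- The isomorphism `ℍ[ℚ_p]ˣ ≃ GL_2(ℚ_p)` of a splitting. -/
noncomputable def splittingUnits (φ : Splitting p) : ℍ[ℚ_[p]]ˣ →* (Mat p)ˣ :=
  Units.map (φ : ℍ[ℚ_[p]] →* Mat p)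

/-- The vertex of the tree that is fixed by the units of the order. -/
noncomputable def baseVertex (φ : Splitting p) : Vertex p := Quotient.mk _ (stableLattice φ)

theorem normSq_unit_ne_zero (x : ℍ[ℚ_[p]]ˣ) : Quaternion.normSq (x : ℍ[ℚ_[p]]) ≠ 0 :=
  (x.isUnit.map Quaternion.normSq).ne_zero

theorem coe_inv_unit (x : ℍ[ℚ_[p]]ˣ) : ((x⁻¹ : ℍ[ℚ_[p]]ˣ) : ℍ[ℚ_[p]]) =
    (Quaternion.normSq (x : ℍ[ℚ_[p]]))⁻¹ • star (x : ℍ[ℚ_[p]]) := by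
  rw [← mul_one ((x⁻¹ : ℍ[ℚ_[p]]ˣ) : ℍ[ℚ_[p]]), Units.inv_mul_eq_iff_eq_mul,
    ← Quaternion.coe_mul_eq_smul, Quaternion.coe_commutes, ← mul_assoc, Quaternion.self_mul_star,
    ← Quaternion.coe_mul, mul_inv_cancel₀ (normSq_unit_ne_zero x), Quaternion.coe_one]

theorem inv_mem_padicOrder {x : ℍ[ℚ_[p]]ˣ} (hx : (x : ℍ[ℚ_[p]]) ∈ padicOrder p)
    (h : ‖Quaternion.normSq (x : ℍ[ℚ_[p]])‖ = 1) :
    ((x⁻¹ : ℍ[ℚ_[p]]ˣ) : ℍ[ℚ_[p]]) ∈ padicOrder p := by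
  rw [coe_inv_unit]
  exact smul_mem_padicOrder (by rw [norm_inv, h, inv_one]) (star_mem_padicOrder hx)

theorem smul_stableLattice_le (φ : Splitting p) {x : ℍ[ℚ_[p]]ˣ}
    (hx : (x : ℍ[ℚ_[p]]) ∈ padicOrder p) :
    (splittingUnits φ x • stableLattice φ).1 ≤ (stableLattice φ).1 := by
  rintro _ ⟨w, hw, rfl⟩
  exact mulVec_mem_stableLattice φ hx hw

theorem smul_baseVertex (φ : Splitting p) {x : ℍ[ℚ_[p]]ˣ} (hx : (x : ℍ[ℚ_[p]]) ∈ padicOrder p)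
    (h : ‖Quaternion.normSq (x : ℍ[ℚ_[p]])‖ = 1) :
    splittingUnits φ x • baseVertex φ = baseVertex φ := by
  refine congrArg (Quotient.mk homothety) (Subtype.ext (le_antisymm
    (smul_stableLattice_le φ hx) fun v hv => ?_))
  refine mem_smul_lattice.2 ⟨(φ ((x⁻¹ : ℍ[ℚ_[p]]ˣ) : ℍ[ℚ_[p]])).mulVec v,
    mulVec_mem_stableLattice φ (inv_mem_padicOrder hx h) hv, ?_⟩
  change (φ (x : ℍ[ℚ_[p]])).mulVec _ = v
  rw [Matrix.mulVec_mulVec, ← map_mul, Units.mul_inv, map_one, Matrix.one_mulVec]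

theorem splittingUnits_algebraMap (φ : Splitting p) (c : ℚ_[p]ˣ) :
    splittingUnits φ (Units.map (algebraMap ℚ_[p] ℍ[ℚ_[p]]).toMonoidHom c) = scalarMat c :=
  Units.ext (φ.commutes c)

/-- Some multiple `y = c x` maps the stable lattice onto itself, so both `y` and `y⁻¹` lie in the
order and the norm of `y` is a unit. -/
theorem exists_scalar_of_smul_baseVertex (hp : p ≠ 2) (φ : Splitting p) {x : ℍ[ℚ_[p]]ˣ}
    (h : splittingUnits φ x • baseVertex φ = baseVertex φ) :
    ∃ c : ℚ_[p], c • (x : ℍ[ℚ_[p]]) ∈ padicOrder p ∧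
      ‖Quaternion.normSq (c • (x : ℍ[ℚ_[p]]))‖ = 1 := by
  obtain ⟨c, hc⟩ : ∃ c : ℚ_[p]ˣ, stableLattice φ
      = scalarMat c • (splittingUnits φ x • stableLattice φ) := Quotient.exact h
  rw [← mul_smul, ← splittingUnits_algebraMap φ c, ← map_mul] at hc
  obtain ⟨y, hy⟩ : ∃ y : ℍ[ℚ_[p]]ˣ,
      y = Units.map (algebraMap ℚ_[p] ℍ[ℚ_[p]]).toMonoidHom c * x := ⟨_, rfl⟩
  have hyx : (y : ℍ[ℚ_[p]]) = (c : ℚ_[p]) • (x : ℍ[ℚ_[p]]) := by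
    rw [← Quaternion.coe_mul_eq_smul, hy]
    rfl
  rw [← hy] at hc
  have hmem : ∀ v, v ∈ (stableLattice φ).1 ↔
      ∃ w ∈ (stableLattice φ).1, (φ (y : ℍ[ℚ_[p]])).mulVec w = v := fun v => by
    conv_lhs => rw [hc]
    exact mem_smul_lattice
  have h1 : (y : ℍ[ℚ_[p]]) ∈ padicOrder p :=
    mem_padicOrder_of_stable hp φ fun v hv => (hmem _).2 ⟨v, hv, rfl⟩
  have h2 : ((y⁻¹ : ℍ[ℚ_[p]]ˣ) : ℍ[ℚ_[p]]) ∈ padicOrder p :=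
    mem_padicOrder_of_stable hp φ fun v hv => by
      obtain ⟨w, hw, rfl⟩ := (hmem v).1 hv
      rwa [Matrix.mulVec_mulVec, ← map_mul, Units.inv_mul, map_one, Matrix.one_mulVec]
  refine ⟨c, hyx ▸ h1, ?_⟩
  rw [← hyx]
  have h3 := norm_normSq_le_one h1
  have h4 := norm_normSq_le_one h2
  have h5 : ‖Quaternion.normSq (y : ℍ[ℚ_[p]])‖ *
      ‖Quaternion.normSq ((y⁻¹ : ℍ[ℚ_[p]]ˣ) : ℍ[ℚ_[p]])‖ = 1 := by
    rw [← norm_mul, ← map_mul, Units.mul_inv, map_one, norm_one]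
  have h6 := norm_nonneg (Quaternion.normSq (y : ℍ[ℚ_[p]]))
  nlinarith

theorem exists_smul_mem_padicOrder (x : ℍ[ℚ_[p]]) :
    ∃ c : ℚ_[p]ˣ, (c : ℚ_[p]) • x ∈ padicOrder p := by
  have key : ∀ y : ℚ_[p], ∃ c : ℚ_[p], c ≠ 0 ∧ ‖c‖ ≤ 1 ∧ ‖c * y‖ ≤ 1 := fun y => by
    by_cases hy : ‖y‖ ≤ 1
    · exact ⟨1, one_ne_zero, by simp, by simpa using hy⟩
    · have hy0 : y ≠ 0 := by
        rintro rfl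
        simp at hy
      refine ⟨y⁻¹, inv_ne_zero hy0, ?_, by rw [inv_mul_cancel₀ hy0]; simp⟩
      rw [norm_inv]
      exact inv_le_one_of_one_le₀ (not_le.1 hy).le
  obtain ⟨c1, n1, i1, h1⟩ := key x.re
  obtain ⟨c2, n2, i2, h2⟩ := key x.imI
  obtain ⟨c3, n3, i3, h3⟩ := key x.imJ
  obtain ⟨c4, n4, i4, h4⟩ := key x.imK
  refine ⟨Units.mk0 (c1 * c2 * (c3 * c4))
    (mul_ne_zero (mul_ne_zero n1 n2) (mul_ne_zero n3 n4)), mem_padicOrder.2 ⟨?_, ?_, ?_, ?_⟩⟩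
  · change ‖c1 * c2 * (c3 * c4) * x.re‖ ≤ 1
    rw [show c1 * c2 * (c3 * c4) * x.re = c1 * x.re * c2 * (c3 * c4) by ring]
    simp only [norm_mul] at *
    exact mul_le_one₀ (mul_le_one₀ h1 (by positivity) i2) (by positivity)
      (mul_le_one₀ i3 (by positivity) i4)
  · change ‖c1 * c2 * (c3 * c4) * x.imI‖ ≤ 1
    rw [show c1 * c2 * (c3 * c4) * x.imI = c2 * x.imI * c1 * (c3 * c4) by ring]
    simp only [norm_mul] at *
    exact mul_le_one₀ (mul_le_one₀ h2 (by positivity) i1) (by positivity)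
      (mul_le_one₀ i3 (by positivity) i4)
  · change ‖c1 * c2 * (c3 * c4) * x.imJ‖ ≤ 1
    rw [show c1 * c2 * (c3 * c4) * x.imJ = c3 * x.imJ * c4 * (c1 * c2) by ring]
    simp only [norm_mul] at *
    exact mul_le_one₀ (mul_le_one₀ h3 (by positivity) i4) (by positivity)
      (mul_le_one₀ i1 (by positivity) i2)
  · change ‖c1 * c2 * (c3 * c4) * x.imK‖ ≤ 1
    rw [show c1 * c2 * (c3 * c4) * x.imK = c4 * x.imK * c3 * (c1 * c2) by ring]
    simp only [norm_mul] at *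
    exact mul_le_one₀ (mul_le_one₀ h4 (by positivity) i3) (by positivity)
      (mul_le_one₀ i1 (by positivity) i2)

theorem exists_smul_baseVertex_eq (φ : Splitting p) (v : Vertex p) :
    ∃ x : ℍ[ℚ_[p]]ˣ, (x : ℍ[ℚ_[p]]) ∈ padicOrder p ∧
      splittingUnits φ x • baseVertex φ = v := by
  induction v using Quotient.inductionOn with | h L => ?_
  obtain ⟨g, hg⟩ := exists_smul_eq (stableLattice φ) L
  let y : ℍ[ℚ_[p]]ˣ := Units.map (φ.symm : Mat p →* ℍ[ℚ_[p]]) g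
  have hy : splittingUnits φ y = g := Units.ext (φ.apply_symm_apply _)
  obtain ⟨c, hc⟩ := exists_smul_mem_padicOrder (y : ℍ[ℚ_[p]])
  refine ⟨Units.map (algebraMap ℚ_[p] ℍ[ℚ_[p]]).toMonoidHom c * y, ?_, ?_⟩
  · rw [← Quaternion.coe_mul_eq_smul] at hc
    exact hc
  · rw [map_mul, splittingUnits_algebraMap, mul_smul, scalarMat_smul, hy]
    exact congrArg (Quotient.mk homothety) hg

/-- Every quaternion of the order whose norm is not a unit has a left divisor in `A'_p`. -/
theorem exists_genA'_factor (hp : p ≠ 2) {x : ℍ[ℚ_[p]]} (hx : x ∈ padicOrder p)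
    (hN : ‖Quaternion.normSq x‖ < 1) :
    ∃ a ∈ genA' p, toPadic p ((p : ℚ)⁻¹ • star a) * x ∈ padicOrder p := by
  have key : ∀ t : ℤ_[p], ∃ (n : ℤ) (s : ℤ_[p]), t = n + p * s := fun t => by
    have h := t.norm_sub_zmodRepr_lt_one
    rw [PadicInt.norm_lt_one_iff_dvd] at h
    obtain ⟨s, hs⟩ := h
    exact ⟨t.zmodRepr, s, by rw [← hs]; push_cast; ring⟩
  obtain ⟨X, rfl⟩ := hx
  obtain ⟨n1, s1, h1⟩ := key X.re
  obtain ⟨n2, s2, h2⟩ := key X.imI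
  obtain ⟨n3, s3, h3⟩ := key X.imJ
  obtain ⟨n4, s4, h4⟩ := key X.imK
  have hdvd : (p : ℤ) ∣ n1 ^ 2 + n2 ^ 2 + n3 ^ 2 + n4 ^ 2 := by
    have hX : ‖X.re ^ 2 + X.imI ^ 2 + X.imJ ^ 2 + X.imK ^ 2‖ < 1 := by
      rw [Quaternion.normSq_def'] at hN
      exact hN
    rw [PadicInt.norm_lt_one_iff_dvd] at hX
    rw [← PadicInt.norm_int_lt_one_iff_dvd, PadicInt.norm_lt_one_iff_dvd]
    have e : ((n1 ^ 2 + n2 ^ 2 + n3 ^ 2 + n4 ^ 2 : ℤ) : ℤ_[p]) =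
        (X.re ^ 2 + X.imI ^ 2 + X.imJ ^ 2 + X.imK ^ 2) - p * (2 * (n1 * s1 + n2 * s2 + n3 * s3 +
          n4 * s4) + p * (s1 ^ 2 + s2 ^ 2 + s3 ^ 2 + s4 ^ 2)) := by
      rw [h1, h2, h3, h4]
      push_cast
      ring
    rw [e]
    exact dvd_sub hX (dvd_mul_right _ _)
  obtain ⟨m, hm⟩ := hdvd
  obtain ⟨a, ha, z, hz, haz⟩ := exists_factor_genA' (Fact.out : p.Prime) hp
    (quat_int_mem_hurwitz n1 n2 n3 n4) (n := m) (by
      simp only [Quaternion.normSq_def', quat_re, quat_imI, quat_imJ, quat_imK]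
      exact_mod_cast hm)
  refine ⟨a, ha, ?_⟩
  have hp0 : (p : ℚ) ≠ 0 := by exact_mod_cast (Fact.out : p.Prime).ne_zero
  -- Modulo `p`, `X` is the integral quaternion `a z`, so `X = a z + p s`. Since `a⁻¹ p = ā`, this
  -- gives `a⁻¹ X = z + ā s`, which is integral.
  have hX : baseChange (algebraMap ℤ_[p] ℚ_[p]) X = toPadic p (a * z) +
      toPadic p (algebraMap ℚ ℍ[ℚ] p) * baseChange (algebraMap ℤ_[p] ℚ_[p]) ⟨s1, s2, s3, s4⟩ := by
    rw [← haz]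
    have e : toPadic p (algebraMap ℚ ℍ[ℚ] p) = algebraMap ℚ_[p] ℍ[ℚ_[p]] p := by
      refine Quaternion.ext _ _ (map_natCast (algebraMap ℚ ℚ_[p]) p) ?_ ?_ ?_
      all_goals exact map_zero (algebraMap ℚ ℚ_[p])
    rw [e, ← Algebra.smul_def]
    have c : ∀ (n : ℤ) (s : ℤ_[p]), algebraMap ℤ_[p] ℚ_[p] (n + p * s)
        = algebraMap ℚ ℚ_[p] n + p * algebraMap ℤ_[p] ℚ_[p] s := fun n s => by simp
    refine Quaternion.ext _ _ ?_ ?_ ?_ ?_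
    · exact (congrArg _ h1).trans (c _ _)
    · exact (congrArg _ h2).trans (c _ _)
    · exact (congrArg _ h3).trans (c _ _)
    · exact (congrArg _ h4).trans (c _ _)
  have e1 : (p : ℚ)⁻¹ • star a * (a * z) = z := by
    rw [← mul_assoc, smul_mul_assoc, Quaternion.star_mul_self, normSq_of_mem_genA' ha,
      Quaternion.smul_coe, inv_mul_cancel₀ hp0, Quaternion.coe_one, one_mul]
  have e2 : (p : ℚ)⁻¹ • star a * algebraMap ℚ ℍ[ℚ] p = star a := by
    rw [← Algebra.commutes, ← Algebra.smul_def, smul_smul, mul_inv_cancel₀ hp0, one_smul]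
  rw [hX, mul_add, ← map_mul, e1, ← mul_assoc, ← map_mul, e2]
  exact add_mem (toPadic_mem_padicOrder hp hz) (mul_mem (toPadic_mem_padicOrder hp
    (star_mem_hurwitz (mem_hurwitz_of_mem_genA' ha))) ⟨_, rfl⟩)

end Local

/-! ### Simple transitivity on the vertices -/

theorem norm_cast_eq_one {p q : ℕ} [Fact p.Prime] (hq : q.Prime) (h : p ≠ q) :
    ‖(q : ℚ_[p])‖ = 1 := by
  refine le_antisymm (by simpa using Padic.norm_int_le_one (p := p) q) (not_lt.1 fun hlt => ?_)
  rw [Padic.norm_natCast_lt_one_iff] at hlt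
  exact h ((Nat.prime_dvd_prime_iff_eq Fact.out hq).1 hlt)

theorem eq_zero_of_sum_sq_eq_one {a b c d : ℤ} (ha : Odd a)
    (h : a ^ 2 + b ^ 2 + c ^ 2 + d ^ 2 = 1) : b = 0 ∧ c = 0 ∧ d = 0 := by
  have h1 : 0 < a ^ 2 := by
    have : a ≠ 0 := by
      rintro rfl
      simp at ha
    positivity
  have h2 := sq_nonneg b
  have h3 := sq_nonneg c
  have h4 := sq_nonneg d
  exact ⟨pow_eq_zero_iff two_ne_zero |>.1 (by omega), pow_eq_zero_iff two_ne_zero |>.1 (by omega),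
    pow_eq_zero_iff two_ne_zero |>.1 (by omega)⟩

/-- An integral quaternion with odd real part that is, up to scalars, a local unit at every prime
dividing its norm is an integer. -/
theorem im_eq_zero_of_local_units (N : ℕ) : ∀ a b c d : ℤ, Odd a →
    a ^ 2 + b ^ 2 + c ^ 2 + d ^ 2 = N →
    (∀ p : Nat.Primes, p.1 ∣ N → ∃ s : ℚ_[p.1],
      s • toPadic p.1 (quat (a : ℚ) b c d) ∈ padicOrder p.1 ∧
      ‖Quaternion.normSq (s • toPadic p.1 (quat (a : ℚ) b c d))‖ = 1) →
    b = 0 ∧ c = 0 ∧ d = 0 := by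
  induction N using Nat.strong_induction_on with | _ N ih => ?_
  intro a b c d ha hN hloc
  by_cases hN1 : N = 1
  · subst hN1
    exact eq_zero_of_sum_sq_eq_one ha hN
  obtain ⟨q, hq, hqN⟩ := Nat.exists_prime_and_dvd hN1
  have hN0 : N ≠ 0 := by
    rintro rfl
    have : a = 0 := by
      refine pow_eq_zero_iff two_ne_zero |>.1 ?_
      have := sq_nonneg a
      have := sq_nonneg b
      have := sq_nonneg c
      have := sq_nonneg d
      omega
    rw [this] at ha
    simp at ha
  have := Fact.mk hq
  obtain ⟨s, hs, hs1⟩ := hloc ⟨q, hq⟩ hqN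
  have hNq : Quaternion.normSq (toPadic q (quat (a : ℚ) b c d)) = (N : ℚ_[q]) := by
    rw [normSq_toPadic]
    have : Quaternion.normSq (quat (a : ℚ) b c d) = (N : ℚ) := by
      simp only [Quaternion.normSq_def', quat_re, quat_imI, quat_imJ, quat_imK]
      exact_mod_cast hN
    rw [this, map_natCast]
  change ‖Quaternion.normSq (s • toPadic q (quat (a : ℚ) b c d))‖ = 1 at hs1
  rw [Quaternion.normSq_smul, hNq, norm_mul, norm_pow] at hs1
  have hNlt : ‖(N : ℚ_[q])‖ < 1 := Padic.norm_natCast_lt_one_iff.2 hqN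
  -- From `|s|² |N| = 1` and `|N| < 1` the scalar `s` is not integral, so integrality of `s x` makes
  -- `q` divide every coordinate. Dividing by `q` replaces `N` by `N / q²` and keeps the real part
  -- odd.
  have hslt : 1 < ‖s‖ := by
    by_contra! hle
    have : ‖s‖ ^ 2 ≤ 1 := pow_le_one₀ (norm_nonneg _) hle
    nlinarith [norm_nonneg (N : ℚ_[q])]
  have hdvd : ∀ m : ℤ, ‖s * algebraMap ℚ ℚ_[q] m‖ ≤ 1 → (q : ℤ) ∣ m := fun m hm => by
    rw [← Padic.norm_intCast_lt_one_iff (p := q)]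
    rw [map_intCast, norm_mul] at hm
    by_contra! hge
    nlinarith
  have hs' := mem_padicOrder.1 hs
  obtain ⟨a, rfl⟩ := hdvd a hs'.1
  obtain ⟨b, rfl⟩ := hdvd b hs'.2.1
  obtain ⟨c, rfl⟩ := hdvd c hs'.2.2.1
  obtain ⟨d, rfl⟩ := hdvd d hs'.2.2.2
  have hM0 : 0 ≤ a ^ 2 + b ^ 2 + c ^ 2 + d ^ 2 := by positivity
  obtain ⟨M, hM⟩ := Int.eq_ofNat_of_zero_le hM0
  have hNM : N = q ^ 2 * M := by
    have : (N : ℤ) = q ^ 2 * M := by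
      rw [← hN]
      linear_combination (q : ℤ) ^ 2 * hM
    exact_mod_cast this
  have hMN : M < N := by
    have hMpos : 0 < M := Nat.pos_of_ne_zero fun h => hN0 (by rw [hNM, h, mul_zero])
    rw [hNM]
    exact lt_mul_of_one_lt_left hMpos (one_lt_pow₀ hq.one_lt two_ne_zero)
  obtain ⟨hb, hc, hd⟩ := ih M hMN a b c d (Int.odd_mul.1 ha).2 hM (by
    intro p hp
    obtain ⟨t, ht, ht1⟩ := hloc p (hNM ▸ hp.mul_left _)
    have e : t • toPadic p.1 (quat ((q * a : ℤ) : ℚ) (q * b : ℤ) (q * c : ℤ) (q * d : ℤ))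
        = (t * q) • toPadic p.1 (quat (a : ℚ) b c d) := by
      ext <;> simp [toPadic, baseChange, mul_assoc]
    exact ⟨t * q, e ▸ ht, e ▸ ht1⟩)
  simp [hb, hc, hd]

variable (φ : ∀ p : unramified S, Splitting p.1.1)

variable (S) in
/-- The localisation `𝒜(ℤ_S)ˣ → ℍ[ℚ_p]ˣ`. -/
noncomputable def padicUnits (p : ℕ) [Fact p.Prime] : (hurwitzS S)ˣ →* ℍ[ℚ_[p]]ˣ :=
  Units.map (((toPadic p).comp (hurwitzS S).val.toRingHom : hurwitzS S →+* ℍ[ℚ_[p]]) :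
    hurwitzS S →* ℍ[ℚ_[p]])

theorem lambdaAction_mk (u : (hurwitzS S)ˣ) (v : ProductVertex S) (p : unramified S) :
    lambdaAction φ (u : Lambda S) v p = splittingUnits (φ p) (padicUnits S p.1.1 u) • v p := rfl

/-- The vertex of the product of trees given by the Hurwitz order. -/
noncomputable def origin : ProductVertex S := fun p => baseVertex (φ p)

theorem mem_unramified_of_dvd {p : Nat.Primes} {n : ℕ} (hn : IsSNumber S n) (hodd : Odd n)
    (hp : p.1 ∣ n) : p ∈ unramified S := by
  refine ⟨hn.2 p hp, ?_⟩
  rintro (h | h)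
  · have : p = ⟨2, Nat.prime_two⟩ := Place.finite.inj h
    rw [this] at hp
    exact Nat.not_even_iff_odd.2 hodd (even_iff_two_dvd.2 hp)
  · cases h

theorem isGoodUnit_mk_eq_one {u : (hurwitzS S)ˣ} (hu : IsGoodUnit u)
    (him : ((u : hurwitzS S) : ℍ[ℚ]).im = 0) : (u : Lambda S) = 1 := by
  obtain ⟨⟨a, b, c, d, h, -⟩, n, hn, hun⟩ := hu
  refine mk_eq_one_of_real hn ?_ hun (a := a)
  rw [h] at him ⊢
  have hb := congrArg (fun q : ℍ[ℚ] => q.imI) him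
  have hc := congrArg (fun q : ℍ[ℚ] => q.imJ) him
  have hd := congrArg (fun q : ℍ[ℚ] => q.imK) him
  simp at hb hc hd
  simp [hb, hc, hd]

/-- The congruence modulo 2 makes the norm of the representative odd, so its prime divisors lie in
`S₀`, and fixing the origin gives the hypothesis of `im_eq_zero_of_local_units` at each of them. -/
theorem eq_one_of_fix_origin {γ : Lambda S} (hγ : γ ∈ Gamma' S)
    (h : lambdaAction φ γ (origin φ) = origin φ) : γ = 1 := by
  obtain ⟨u, rfl, hu⟩ := exists_isGoodUnit hγ
  refine isGoodUnit_mk_eq_one hu ?_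
  obtain ⟨⟨a, b, c, d, hx, ha, hb, hcd⟩, n, hn, hun⟩ := hu
  have hN : a ^ 2 + b ^ 2 + c ^ 2 + d ^ 2 = n := by
    rw [hx] at hun
    simp only [Quaternion.normSq_def', quat_re, quat_imI, quat_imJ, quat_imK] at hun
    exact_mod_cast hun
  have hodd : Odd n := by
    have h1 : Odd (n : ℤ) := by
      rw [← hN, add_assoc]
      refine (ha.pow.add_even (hb.pow_of_ne_zero two_ne_zero)).add_even ?_
      have : c ^ 2 + d ^ 2 = (c + d) * (c + d) - 2 * (c * d) := by ring
      rw [this]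
      exact (hcd.mul_left _).sub (even_two_mul _)
    exact_mod_cast h1
  obtain ⟨rfl, rfl, rfl⟩ := im_eq_zero_of_local_units n a b c d ha hN (by
    intro p hp
    have hpS := mem_unramified_of_dvd hn hodd hp
    have h1 := congrFun h ⟨p, hpS⟩
    rw [lambdaAction_mk] at h1
    have h2 := exists_scalar_of_smul_baseVertex (isSNumber_and_ne_two (p := ⟨p, hpS⟩)).2 _ h1
    rw [← hx]
    exact h2)
  rw [hx]
  ext <;> simp

/-- Induction on the sum of the valuations `n p` of the local norms, finite in number because `S` is
finite. Dividing by an element of `A'_q` on the left lowers `n q` by one; at the other primes that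
element is a unit of the order. When all valuations vanish, every component fixes its base vertex.
-/
theorem exists_smul_origin (hfin : S.Finite) (w : ProductVertex S) :
    ∃ γ ∈ Gamma' S, lambdaAction φ γ (origin φ) = w := by
  classical
  have hfinU : (unramified S).Finite :=
    (hfin.preimage (f := Place.finite) (fun a _ b _ h => Place.finite.inj h)).subset
      fun p hp => hp.1
  have := hfinU.fintype
  have main : ∀ k : ℕ, ∀ (n : unramified S → ℕ) (x : ∀ p : unramified S, ℍ[ℚ_[p.1.1]]ˣ),
      ∑ p, n p = k → (∀ p, (x p : ℍ[ℚ_[p.1.1]]) ∈ padicOrder p.1.1) →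
      (∀ p, ‖Quaternion.normSq (x p : ℍ[ℚ_[p.1.1]])‖ * (p.1.1 : ℝ) ^ n p = 1) →
      ∃ γ ∈ Gamma' S, lambdaAction φ γ (origin φ) =
        fun p => splittingUnits (φ p) (x p) • baseVertex (φ p) := by
    intro k
    induction k with
    | zero =>
      intro n x hn hx hN
      refine ⟨1, one_mem _, ?_⟩
      rw [map_one]
      funext p
      have h0 : n p = 0 := Finset.sum_eq_zero_iff.1 hn p (Finset.mem_univ p)
      have h1 := hN p
      rw [h0, pow_zero, mul_one] at h1
      exact (smul_baseVertex (φ p) (hx p) h1).symm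
    | succ k ih =>
      intro n x hn hx hN
      obtain ⟨q, -, hq⟩ : ∃ q ∈ Finset.univ, n q ≠ 0 :=
        Finset.exists_ne_zero_of_sum_ne_zero (by omega)
      have hq1 : (1 : ℝ) < q.1.1 := by exact_mod_cast q.1.2.one_lt
      have hlt : ‖Quaternion.normSq (x q : ℍ[ℚ_[q.1.1]])‖ < 1 := by
        have h1 := hN q
        have h2 : 1 < (q.1.1 : ℝ) ^ n q := one_lt_pow₀ hq1 hq
        by_contra! hge
        nlinarith
      obtain ⟨a, ha, hax⟩ := exists_genA'_factor isSNumber_and_ne_two.2 (hx q) hlt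
      obtain ⟨u, hu, hu', huΓ⟩ := exists_unit_of_mem_genA' ha
      have hcoe : ∀ p : unramified S, ((padicUnits S p.1.1 u⁻¹ : ℍ[ℚ_[p.1.1]]ˣ) : ℍ[ℚ_[p.1.1]]) =
          toPadic p.1.1 ((q.1.1 : ℚ)⁻¹ • star a) := fun p =>
        congrArg (toPadic p.1.1) hu'
      have hnorm : ∀ p : unramified S, ‖Quaternion.normSq
          ((padicUnits S p.1.1 u⁻¹ : ℍ[ℚ_[p.1.1]]ˣ) : ℍ[ℚ_[p.1.1]])‖
            = ‖(q.1.1 : ℚ_[p.1.1])‖⁻¹ := fun p => by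
        have hq0 : (q.1.1 : ℚ) ≠ 0 := by exact_mod_cast q.1.2.ne_zero
        rw [hcoe, normSq_toPadic, Quaternion.normSq_smul, Quaternion.normSq_star,
          normSq_of_mem_genA' ha, ← norm_inv]
        congr 1
        rw [show ((q.1.1 : ℚ)⁻¹) ^ 2 * q.1.1 = (q.1.1 : ℚ)⁻¹ by field_simp, map_inv₀, map_natCast]
      obtain ⟨γ, hγ, hγw⟩ := ih (Function.update n q (n q - 1))
        (fun p => padicUnits S p.1.1 u⁻¹ * x p) (by
          have h1 := Finset.sum_update_of_mem (Finset.mem_univ q) n (n q - 1)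
          have h2 := Finset.add_sum_erase Finset.univ n (Finset.mem_univ q)
          rw [Finset.sdiff_singleton_eq_erase] at h1
          omega)
        (by
          intro p
          rw [Units.val_mul, hcoe]
          by_cases hpq : p = q
          · subst hpq
            exact hax
          · have hne : p.1.1 ≠ q.1.1 := fun h => hpq (Subtype.ext (Subtype.ext h))
            refine mul_mem ?_ (hx p)
            have e : toPadic p.1.1 ((q.1.1 : ℚ)⁻¹ • star a)
                = (q.1.1 : ℚ_[p.1.1])⁻¹ • toPadic p.1.1 (star a) := by
              ext <;> simp [toPadic, baseChange]
            rw [e]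
            exact smul_mem_padicOrder (by rw [norm_inv, norm_cast_eq_one q.1.2 hne, inv_one])
              (toPadic_mem_padicOrder isSNumber_and_ne_two.2
                (star_mem_hurwitz (mem_hurwitz_of_mem_genA' ha))))
        (by
          intro p
          rw [Units.val_mul, map_mul, norm_mul, hnorm]
          by_cases hpq : p = q
          · subst hpq
            rw [Function.update_self, Padic.norm_p, inv_inv]
            obtain ⟨m, hm⟩ := Nat.exists_eq_succ_of_ne_zero hq
            have h1 := hN p
            rw [hm] at h1 ⊢
            rw [Nat.succ_sub_one]
            rw [pow_succ] at h1
            linarith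
          · have hne : p.1.1 ≠ q.1.1 := fun h => hpq (Subtype.ext (Subtype.ext h))
            rw [Function.update_of_ne hpq, norm_cast_eq_one q.1.2 hne, inv_one, one_mul]
            exact hN p)
      refine ⟨u * γ, mul_mem huΓ hγ, ?_⟩
      rw [map_mul, Equiv.Perm.mul_apply, hγw]
      funext p
      rw [lambdaAction_mk, ← mul_smul, ← map_mul, ← mul_assoc, ← map_mul, mul_inv_cancel, map_one,
        one_mul]
  choose x hx hxw using fun p => exists_smul_baseVertex_eq (φ p) (w p)
  have hn : ∀ p : unramified S, ∃ n : ℕ,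
      ‖Quaternion.normSq (x p : ℍ[ℚ_[p.1.1]])‖ * (p.1.1 : ℝ) ^ n = 1 := fun p => by
    have h0 := normSq_unit_ne_zero (x p)
    have h1 := norm_normSq_le_one (hx p)
    have hp1 : (1 : ℝ) < p.1.1 := by exact_mod_cast p.1.2.one_lt
    obtain ⟨m, hm⟩ := Int.eq_ofNat_of_zero_le ((Padic.norm_le_one_iff_val_nonneg _).1 h1)
    refine ⟨m, ?_⟩
    rw [Padic.norm_eq_zpow_neg_valuation h0, hm, zpow_neg, zpow_natCast]
    exact inv_mul_cancel₀ (pow_ne_zero _ (by linarith))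
  choose n hn using hn
  obtain ⟨γ, hγ, h⟩ := main _ n x rfl hx hn
  exact ⟨γ, hγ, h.trans (funext hxw)⟩

theorem eq_one_of_fix (hfin : S.Finite) {γ : Lambda S} (hγ : γ ∈ Gamma' S) {v : ProductVertex S}
    (h : lambdaAction φ γ v = v) : γ = 1 := by
  obtain ⟨g, hg, rfl⟩ := exists_smul_origin φ hfin v
  have h1 : g⁻¹ * γ * g = 1 := by
    refine eq_one_of_fix_origin φ (mul_mem (mul_mem (inv_mem hg) hγ) hg) ?_
    rw [map_mul, map_mul, Equiv.Perm.mul_apply, Equiv.Perm.mul_apply, h, map_inv,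
      Equiv.Perm.inv_eq_iff_eq]
  rw [mul_assoc, inv_mul_eq_one] at h1
  exact mul_eq_right.1 h1.symm

/-! ### Torsion and stabilisers of cells -/

theorem im_eq_zero_of_mem_scalarUnits {u : (hurwitzS S)ˣ} (hu : u ∈ scalarUnits S) :
    ((u : hurwitzS S) : ℍ[ℚ]).im = 0 := by
  obtain ⟨c, rfl⟩ := hu
  exact Quaternion.im_coe (R := ℚ) ((c : sIntegers S) : ℚ)

/-- With `v` the imaginary part, `v²` is an even integer, so all powers of `a + v` lie in `ℤ + ℤ v`.
Each multiplication by `a + v` keeps `α` odd and flips the parity of `β`. -/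
theorem exists_pow_eq {a b c d : ℤ} (ha : Odd a) (hm : Even (b ^ 2 + c ^ 2 + d ^ 2)) (n : ℕ) :
    ∃ α β : ℤ, Odd α ∧ (Odd β ↔ Odd n) ∧
      (quat (a : ℚ) b c d) ^ n = quat (α : ℚ) (β * b) (β * c) (β * d) := by
  induction n with
  | zero => exact ⟨1, 0, by simp, by simp, by ext <;> simp⟩
  | succ n ih =>
    obtain ⟨α, β, hα, hβ, h⟩ := ih
    refine ⟨α * a - β * (b ^ 2 + c ^ 2 + d ^ 2), α + β * a,
      (hα.mul ha).sub_even (hm.mul_left _), ?_, ?_⟩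
    · rw [Nat.odd_add_one, ← hβ]
      rw [← Int.not_even_iff_odd] at hα ha ⊢
      simp only [parity_simps]
      simp [hα, ha, Int.not_odd_iff_even]
    · rw [pow_succ, h]
      ext <;> simp <;> ring

/-- For odd `n` the coefficient `β` is odd, hence nonzero; a central `n`-th power thus forces a zero
imaginary part. -/
theorem eq_one_of_pow_odd {γ : Lambda S} (hγ : γ ∈ Gamma' S) {n : ℕ} (hn : Odd n)
    (h : γ ^ n = 1) : γ = 1 := by
  obtain ⟨u, rfl, hu⟩ := exists_isGoodUnit hγ
  refine isGoodUnit_mk_eq_one hu ?_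
  obtain ⟨⟨a, b, c, d, hx, ha, hb, hcd⟩, -⟩ := hu
  rw [← QuotientGroup.mk_pow, QuotientGroup.eq_one_iff] at h
  have him := im_eq_zero_of_mem_scalarUnits h
  have hm : Even (b ^ 2 + c ^ 2 + d ^ 2) := by
    have : b ^ 2 + c ^ 2 + d ^ 2 = b ^ 2 + (c + d) * (c + d) - 2 * (c * d) := by ring
    rw [this]
    exact ((hb.pow_of_ne_zero two_ne_zero).add (hcd.mul_left _)).sub (even_two_mul _)
  obtain ⟨α, β, -, hβ, hpow⟩ := exists_pow_eq ha hm n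
  have hβ0 : (β : ℚ) ≠ 0 := by
    have := hβ.2 hn
    rintro h0
    have h0 : β = 0 := by exact_mod_cast h0
    rw [h0] at this
    simp at this
  rw [Units.val_pow_eq_pow_val, SubmonoidClass.coe_pow, hx, hpow] at him
  have h1 := congrArg (fun q : ℍ[ℚ] => q.imI) him
  have h2 := congrArg (fun q : ℍ[ℚ] => q.imJ) him
  have h3 := congrArg (fun q : ℍ[ℚ] => q.imK) him
  simp [hβ0] at h1 h2 h3
  rw [hx]
  ext <;> simp [h1, h2, h3]

theorem eq_one_of_sq {γ : Lambda S} (hγ : γ ∈ Gamma' S) (h : γ ^ 2 = 1) : γ = 1 := by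
  obtain ⟨u, rfl, hu⟩ := exists_isGoodUnit hγ
  refine isGoodUnit_mk_eq_one hu ?_
  obtain ⟨⟨a, b, c, d, hx, ha, -⟩, -⟩ := hu
  rw [← QuotientGroup.mk_pow, QuotientGroup.eq_one_iff] at h
  have him := im_eq_zero_of_mem_scalarUnits h
  have ha0 : (a : ℚ) ≠ 0 := by
    rintro h0
    have h0 : a = 0 := by exact_mod_cast h0
    rw [h0] at ha
    simp at ha
  rw [Units.val_pow_eq_pow_val, SubmonoidClass.coe_pow, hx, pow_two] at him
  have h1 := congrArg (fun q : ℍ[ℚ] => q.imI) him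
  have h2 := congrArg (fun q : ℍ[ℚ] => q.imJ) him
  have h3 := congrArg (fun q : ℍ[ℚ] => q.imK) him
  simp at h1 h2 h3
  have e1 : (b : ℚ) = 0 := mul_left_cancel₀ ha0 (by linear_combination h1 / 2)
  have e2 : (c : ℚ) = 0 := mul_left_cancel₀ ha0 (by linear_combination h2 / 2)
  have e3 : (d : ℚ) = 0 := mul_left_cancel₀ ha0 (by linear_combination h3 / 2)
  rw [hx]
  ext <;> simp [e1, e2, e3]

theorem eq_one_of_pow (n : ℕ) : ∀ γ ∈ Gamma' S, 0 < n → γ ^ n = 1 → γ = 1 := by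
  induction n using Nat.strong_induction_on with | _ n ih => ?_
  intro γ hγ hn h
  rcases n.even_or_odd with ⟨m, rfl⟩ | hodd
  · refine ih m (by omega) γ hγ (by omega) (eq_one_of_sq (pow_mem hγ m) ?_)
    rw [← pow_mul, mul_two, h]
  · exact eq_one_of_pow_odd hγ hodd h

/-- In each factor the cell has at most two vertices, which `γ` permutes, so `γ²` fixes a vertex of
the cell; no inversion survives because involutions are excluded by `eq_one_of_sq`. -/
theorem eq_one_of_preserves_cell (hfin : S.Finite) {γ : Lambda S} (hγ : γ ∈ Gamma' S)
    {C : Set (ProductVertex S)} (hC : IsCell C) (h : lambdaAction φ γ '' C = C) : γ = 1 := by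
  classical
  refine eq_one_of_sq hγ ?_
  obtain ⟨c, hc, rfl⟩ := hC
  have hne : ∀ p, (c p).Nonempty := fun p => by
    rcases hc p with ⟨v, hv⟩ | ⟨v, w, -, hv⟩ <;> rw [hv]
    · exact Set.singleton_nonempty v
    · exact Set.insert_nonempty _ _
  choose v hv using hne
  obtain ⟨u, rfl⟩ := QuotientGroup.mk_surjective γ
  let g (p : unramified S) := splittingUnits (φ p) (padicUnits S p.1.1 u)
  have hmap : ∀ p, ∀ y ∈ c p, g p • y ∈ c p := fun p y hy => by
    -- Any vertex of the factor `c p` extends to a vertex of the product cell, so preservation of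
    -- the product gives preservation of each factor.
    have h1 : Function.update v p y ∈ Set.univ.pi c := by
      intro q _
      by_cases hq : q = p
      · subst hq
        simpa using hy
      · simpa [hq] using hv q
    have h2 : lambdaAction φ (u : Lambda S) (Function.update v p y) ∈ Set.univ.pi c := by
      rw [← h]
      exact ⟨_, h1, rfl⟩
    have h3 := h2 p (Set.mem_univ p)
    rwa [lambdaAction_mk, Function.update_self] at h3
  refine eq_one_of_fix φ hfin (pow_mem hγ 2) (v := v) ?_
  rw [pow_two, map_mul, Equiv.Perm.mul_apply]
  funext p
  rw [lambdaAction_mk, lambdaAction_mk]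
  change g p • g p • v p = v p
  have m0 := hv p
  have m1 := hmap p _ m0
  have m2 := hmap p _ m1
  have inj : ∀ a b : Vertex p.1.1, g p • a = g p • b → a = b := fun a b => smul_left_cancel _
  rcases hc p with ⟨a, ha⟩ | ⟨a, b, -, ha⟩
  · rw [ha] at m0 m2
    exact m2.trans m0.symm
  · have k1 := inj (g p • v p) (v p)
    rw [ha] at m0 m1 m2
    simp only [Set.mem_insert_iff, Set.mem_singleton_iff] at m0 m1 m2
    grind

end HurwitzLattice

theorem theorem3p12 (S : Set Place) (hfin : S.Finite)
    (hS : ramified ⊆ S) :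
    (∀ γ ∈ Gamma' S, ∃ u : (hurwitzS S)ˣ,
      (u : Lambda S) = γ ∧
      ((u : hurwitzS S) : ℍ[ℚ]) ∈ lipschitz ∧
      ∃ r ∈ ({1, 1 + qj ℚ + qk ℚ} : Set ℍ[ℚ]),
        ∃ z ∈ lipschitz, ((u : hurwitzS S) : ℍ[ℚ]) - r = 2 * z) ∧
    (∀ φ : ∀ p : unramified S, Splitting p.1.1,
      (∀ v w : ProductVertex S,
        ∃! γ : Gamma' S, lambdaAction φ γ v = w) ∧
      (∀ γ ∈ Gamma' S, γ ≠ 1 →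
        ∀ C : Set (ProductVertex S), IsCell C →
          lambdaAction φ γ '' C ≠ C)) ∧
    (∀ γ ∈ Gamma' S, IsOfFinOrder γ → γ = 1) := by
  refine ⟨fun γ hγ => ?_, fun φ => ⟨fun v w => ?_, fun γ hγ hne C hC h =>
    hne (eq_one_of_preserves_cell φ hfin hγ hC h)⟩, fun γ hγ h => ?_⟩
  · obtain ⟨u, hu, hgood⟩ := exists_isGoodUnit hγ
    exact ⟨u, hu, hgood.1.spec⟩
  · obtain ⟨g, hg, rfl⟩ := exists_smul_origin φ hfin v
    obtain ⟨k, hk, rfl⟩ := exists_smul_origin φ hfin w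
    refine ⟨⟨k * g⁻¹, mul_mem hk (inv_mem hg)⟩, ?_, ?_⟩
    · change lambdaAction φ (k * g⁻¹) _ = _
      rw [map_mul, Equiv.Perm.mul_apply, map_inv]
      exact congrArg _ (Equiv.Perm.inv_eq_iff_eq.2 rfl)
    · rintro ⟨γ, hγ⟩ h
      change lambdaAction φ γ _ = _ at h
      have h1 : k⁻¹ * γ * g = 1 := by
        refine eq_one_of_fix_origin φ (mul_mem (mul_mem (inv_mem hk) hγ) hg) ?_
        rw [map_mul, map_mul, Equiv.Perm.mul_apply, Equiv.Perm.mul_apply, h, map_inv,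
          Equiv.Perm.inv_eq_iff_eq]
      ext1
      rw [mul_assoc, inv_mul_eq_one] at h1
      exact eq_mul_inv_of_mul_eq h1.symm
  · obtain ⟨n, hn, hpow⟩ := isOfFinOrder_iff_pow_eq_one.1 h
    exact eq_one_of_pow n γ hγ hn hpow
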